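/- **Corollary 1.5 (Schatten norms).** Let $\mathcal F$ be the Fock space of entire functions $F:\mathbb C\to\mathbb C$ with $\|F\|^2=\int_{\mathbb C}|F(z)|^2e^{-\pi|z|^2}\,dA(z)<\infty$, regarded as a closed subspace of $L^2(\mathbb C,e^{-\pi|z|^2}dA)$, where $dA$ is Lebesgue measure. Let $P$ be the orthogonal projection of this $L^2$ space onto $\mathcal F$. For a measurable set $\Omega\subset\mathbb C$ of finite area $|\Omega|$ let $T_\Omega=P\chi_\Omega:\mathcal F\to\mathcal F$ be the Toeplitz operator of $\Omega$, let $\lambda_1(\Omega)\ge\lambda_2(\Omega)\ge\cdots$ be its positive eigenvalues repeated according to multiplicity, and put $$\|T_\Omega\|_p=\Big(\sum_{k}\lambda_k(\Omega)^p\Big)^{1/p}\in[0,\infty]\qquad(0<p<\infty).$$ Call a measurable set $\Omega$ circularly symmetric if there are $w\in\mathbb C$ and a measurable $E\subset[0,\infty)$ such that $\Omega=\{z\in\mathbb C:|z-w|\in E\}$. Let $\Omega$ be a circularly symmetric set of finite area and let $B\subset\mathbb C$ be a ball with $|B|=|\Omega|$. Then $$\|T_\Omega\|_p\le\|T_B\|_p<\infty\quad\text{for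 every }p>1,\qquad \|T_B\|_p\le\|T_\Omega\|_p\ \text{ and }\ \|T_B\|_p<\infty\quad\text{for every }0<p<1.$$ -/

import Mathlib

open MeasureTheory Filter Topology
open scoped ENNReal

namespace FockToeplitz

/-- The Gaussian measure `e^{-π|z|²} dA(z)` on the complex plane. -/
noncomputable def gaussianMeasure : Measure ℂ :=
  (volume : Measure ℂ).withDensity fun z => ENNReal.ofReal (Real.exp (-Real.pi * ‖z‖ ^ 2))

/-- The Hilbert space `L²(ℂ, e^{-π|z|²} dA(z))`. -/
abbrev L2Gauss : Type := Lp ℂ 2 gaussianMeasure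

/-- The Fock space: the elements of `L²(ℂ, e^{-π|z|²} dA(z))` that are represented by an entire
function, with the norm and inner product inherited from `L²`. -/
noncomputable def fockSpace : Submodule ℂ L2Gauss where
  carrier := {f | ∃ F : ℂ → ℂ, Differentiable ℂ F ∧ (f : ℂ → ℂ) =ᵐ[gaussianMeasure] F}
  zero_mem' := ⟨0, differentiable_const 0, Lp.coeFn_zero _ _ _⟩
  add_mem' := by
    rintro f g ⟨F, hF, hfF⟩ ⟨G, hG, hgG⟩
    exact ⟨F + G, hF.add hG, (Lp.coeFn_add f g).trans (hfF.add hgG)⟩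
  smul_mem' := by
    rintro c f ⟨F, hF, hfF⟩
    exact ⟨c • F, hF.const_smul c, (Lp.coeFn_smul c f).trans (hfF.const_smul c)⟩

/-! ### The Fock space is closed, so that the orthogonal projection onto it exists -/

theorem two_pi_mul_enorm_le {G : ℂ → ℂ} (hG : Differentiable ℂ G) (z : ℂ) (r : ℝ) :
    ENNReal.ofReal (2 * Real.pi) * ‖G z‖ₑ ≤
      ∫⁻ θ in Set.Ioo (-Real.pi) Real.pi, ‖G (circleMap z r θ)‖ₑ := by
  have hmean : Real.circleAverage G z r = G z := hG.diffContOnCl.circleAverage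
  have hper : Function.Periodic (fun θ => G (circleMap z r θ)) (2 * Real.pi) := fun θ => by
    simp only [periodic_circleMap z r θ]
  have hint : ∫ θ in (-Real.pi)..Real.pi, G (circleMap z r θ) = (2 * Real.pi : ℝ) • G z := by
    have h := hper.intervalIntegral_add_eq (-Real.pi) 0
    rw [show -Real.pi + 2 * Real.pi = Real.pi by ring, zero_add] at h
    rw [h, ← hmean, Real.circleAverage, smul_smul, mul_inv_cancel₀ (by positivity), one_smul]
  have h1 : ENNReal.ofReal (2 * Real.pi) * ‖G z‖ₑ = ‖(2 * Real.pi : ℝ) • G z‖ₑ := by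
    rw [enorm_smul, Real.enorm_eq_ofReal (by positivity)]
  rw [h1, ← hint, intervalIntegral.integral_of_le (by linarith [Real.pi_pos]),
    integral_Ioc_eq_integral_Ioo]
  exact enorm_integral_le_lintegral_enorm _

theorem half_enorm_le_lintegral_ball {G : ℂ → ℂ} (hG : Differentiable ℂ G) (z : ℂ) :
    ENNReal.ofReal (1 / 2) * ‖G z‖ₑ ≤ ∫⁻ w in Metric.ball z 1, ‖G w‖ₑ := by
  have hGc : Continuous G := hG.continuous
  have e1 : ∫⁻ w in Metric.ball z 1, ‖G w‖ₑ =
      ∫⁻ w, (Metric.ball (0 : ℂ) 1).indicator (fun w => ‖G (z + w)‖ₑ) w := by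
    rw [← lintegral_indicator measurableSet_ball, ← lintegral_add_left_eq_self _ z]
    refine lintegral_congr fun w => ?_
    simp [Set.indicator, dist_eq_norm]
  rw [e1, ← Complex.lintegral_comp_polarCoord_symm]
  have hsub : Set.Ioo (1 / 2 : ℝ) 1 ×ˢ Set.Ioo (-Real.pi) Real.pi ⊆ polarCoord.target := by
    rintro ⟨r, θ⟩ ⟨hr, hθ⟩
    exact ⟨lt_trans (by norm_num) hr.1, hθ⟩
  refine le_trans ?_ (lintegral_mono_set hsub)
  have hmeas : MeasurableSet (Set.Ioo (1 / 2 : ℝ) 1 ×ˢ Set.Ioo (-Real.pi) Real.pi) :=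
    measurableSet_Ioo.prod measurableSet_Ioo
  have e2 : ∫⁻ p in Set.Ioo (1 / 2 : ℝ) 1 ×ˢ Set.Ioo (-Real.pi) Real.pi,
      ENNReal.ofReal (1 / 2) * ‖G (circleMap z p.1 p.2)‖ₑ ≤
      ∫⁻ p in Set.Ioo (1 / 2 : ℝ) 1 ×ˢ Set.Ioo (-Real.pi) Real.pi,
        ENNReal.ofReal p.1 • (Metric.ball (0 : ℂ) 1).indicator (fun w => ‖G (z + w)‖ₑ)
          (Complex.polarCoord.symm p) := by
    refine setLIntegral_mono' hmeas ?_
    rintro ⟨r, θ⟩ ⟨hr, hθ⟩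
    have hr' : (1 / 2 : ℝ) < r ∧ r < 1 := hr
    have hmem : Complex.polarCoord.symm (r, θ) ∈ Metric.ball (0 : ℂ) 1 := by
      rw [mem_ball_zero_iff, Complex.norm_polarCoord_symm, abs_of_pos (by linarith)]
      exact hr'.2
    have hc : z + Complex.polarCoord.symm (r, θ) = circleMap z r θ := by
      rw [Complex.polarCoord_symm_apply, circleMap, Complex.exp_mul_I]
      simp
    rw [Set.indicator_of_mem hmem, hc, smul_eq_mul]
    gcongr
    exact hr'.1.le
  refine le_trans ?_ e2
  have hcont : Continuous fun p : ℝ × ℝ => G (circleMap z p.1 p.2) := by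
    unfold circleMap
    fun_prop
  have hm : Measurable fun p : ℝ × ℝ => ‖G (circleMap z p.1 p.2)‖ₑ := hcont.measurable.enorm
  rw [lintegral_const_mul _ hm, Measure.volume_eq_prod, ← Measure.prod_restrict,
    lintegral_prod _ hm.aemeasurable]
  gcongr
  calc ‖G z‖ₑ
      ≤ ENNReal.ofReal (2 * Real.pi) * ‖G z‖ₑ * volume (Set.Ioo (1 / 2 : ℝ) 1) := by
        rw [Real.volume_Ioo, mul_right_comm, ← ENNReal.ofReal_mul (by positivity)]
        refine le_mul_of_one_le_left zero_le ?_
        rw [ENNReal.one_le_ofReal]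
        linarith [Real.pi_gt_three]
    _ = ∫⁻ _ in Set.Ioo (1 / 2 : ℝ) 1, ENNReal.ofReal (2 * Real.pi) * ‖G z‖ₑ := by
        rw [setLIntegral_const]
    _ ≤ _ := lintegral_mono fun r => two_pi_mul_enorm_le hG z r

/-- Point evaluations are bounded, locally uniformly, by the norm of the Fock space. -/
theorem norm_le_mul_norm (R : ℝ) : ∃ C : ℝ, ∀ (f : L2Gauss) (F : ℂ → ℂ), Differentiable ℂ F →
    (f : ℂ → ℂ) =ᵐ[gaussianMeasure] F → ∀ z ∈ Metric.closedBall (0 : ℂ) R, ‖F z‖ ≤ C * ‖f‖ := by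
  set a : ℝ := 1 / 2 * Real.exp (-Real.pi * (R + 1) ^ 2) with ha
  have ha0 : 0 < a := by positivity
  refine ⟨Real.sqrt a⁻¹, fun f F hF hfF z hz => ?_⟩
  have hF2 : Differentiable ℂ fun w => F w ^ 2 := hF.pow 2
  have hnorm : ENNReal.ofReal (‖f‖ ^ 2) = ∫⁻ w, ‖F w‖ₑ ^ 2 ∂gaussianMeasure := by
    have h1 : ∫⁻ w, ‖F w‖ₑ ^ 2 ∂gaussianMeasure =
        ∫⁻ w, ‖(f : ℂ → ℂ) w‖ₑ ^ 2 ∂gaussianMeasure :=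
      lintegral_congr_ae (hfF.mono fun w hw => by simp only [hw])
    have h2 := eLpNorm_nnreal_pow_eq_lintegral (p := 2) (f := (f : ℂ → ℂ))
      (μ := gaussianMeasure) (by norm_num)
    simp only [ENNReal.coe_ofNat, NNReal.coe_ofNat, ENNReal.rpow_ofNat] at h2
    rw [h1, ← h2, ENNReal.ofReal_pow (norm_nonneg _), Lp.norm_def,
      ENNReal.ofReal_toReal (Lp.eLpNorm_ne_top f)]
  have hw : ∫⁻ w, ‖F w‖ₑ ^ 2 ∂gaussianMeasure =
      ∫⁻ w, ENNReal.ofReal (Real.exp (-Real.pi * ‖w‖ ^ 2)) * ‖F w‖ₑ ^ 2 := by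
    have hFm : Measurable F := hF.continuous.measurable
    rw [gaussianMeasure, lintegral_withDensity_eq_lintegral_mul _ (by fun_prop) (by fun_prop)]
    rfl
  have hz' : ‖z‖ ≤ R := by simpa using hz
  have key : ENNReal.ofReal (a * ‖F z‖ ^ 2) ≤ ENNReal.ofReal (‖f‖ ^ 2) := by
    calc ENNReal.ofReal (a * ‖F z‖ ^ 2)
        = ENNReal.ofReal (Real.exp (-Real.pi * (R + 1) ^ 2)) *
            (ENNReal.ofReal (1 / 2) * ‖F z ^ 2‖ₑ) := by
          rw [← ofReal_norm, norm_pow, ← ENNReal.ofReal_mul (by positivity),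
            ← ENNReal.ofReal_mul (by positivity), ha]
          congr 1
          ring
      _ ≤ ENNReal.ofReal (Real.exp (-Real.pi * (R + 1) ^ 2)) *
            ∫⁻ w in Metric.ball z 1, ‖F w ^ 2‖ₑ := by
          gcongr
          exact half_enorm_le_lintegral_ball hF2 z
      _ = ∫⁻ w in Metric.ball z 1,
            ENNReal.ofReal (Real.exp (-Real.pi * (R + 1) ^ 2)) * ‖F w ^ 2‖ₑ := by
          rw [lintegral_const_mul' _ _ ENNReal.ofReal_ne_top]
      _ ≤ ∫⁻ w in Metric.ball z 1,
            ENNReal.ofReal (Real.exp (-Real.pi * ‖w‖ ^ 2)) * ‖F w‖ₑ ^ 2 := by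
          refine setLIntegral_mono' measurableSet_ball fun w hwz => ?_
          have hwR : ‖w‖ ≤ R + 1 := by
            have h1 : ‖w - z‖ < 1 := by simpa [dist_eq_norm] using hwz
            have h2 : ‖w‖ ≤ ‖w - z‖ + ‖z‖ := by simpa using norm_add_le (w - z) z
            linarith
          rw [enorm_pow]
          gcongr ENNReal.ofReal (Real.exp ?_) * _
          have : ‖w‖ ^ 2 ≤ (R + 1) ^ 2 := by gcongr
          nlinarith [Real.pi_pos]
      _ ≤ ∫⁻ w, ENNReal.ofReal (Real.exp (-Real.pi * ‖w‖ ^ 2)) * ‖F w‖ₑ ^ 2 :=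
          setLIntegral_le_lintegral _ _
      _ = ENNReal.ofReal (‖f‖ ^ 2) := by rw [hnorm, hw]
  have key' : a * ‖F z‖ ^ 2 ≤ ‖f‖ ^ 2 := (ENNReal.ofReal_le_ofReal_iff (by positivity)).1 key
  refine (sq_le_sq₀ (norm_nonneg _) (by positivity)).1 ?_
  rw [mul_pow, Real.sq_sqrt (by positivity), inv_mul_eq_div, le_div_iff₀ ha0]
  linarith

theorem isClosed_fockSpace : IsClosed (fockSpace : Set L2Gauss) := by
  refine IsSeqClosed.isClosed fun f g hf hfg => ?_
  choose F hF hfF using hf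
  have hcauchy : CauchySeq f := hfg.cauchySeq
  have hunif : ∀ R : ℝ, UniformCauchySeqOn F atTop (Metric.closedBall (0 : ℂ) R) := by
    intro R
    obtain ⟨C, hC⟩ := norm_le_mul_norm R
    have hC' : ∀ m n, ∀ z ∈ Metric.closedBall (0 : ℂ) R,
        ‖F m z - F n z‖ ≤ (|C| + 1) * ‖f m - f n‖ := fun m n z hz =>
      (hC (f m - f n) (F m - F n) ((hF m).sub (hF n))
        ((Lp.coeFn_sub _ _).trans ((hfF m).sub (hfF n))) z hz).trans
        (mul_le_mul_of_nonneg_right (by linarith [le_abs_self C]) (norm_nonneg _))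
    rw [Metric.uniformCauchySeqOn_iff]
    intro ε hε
    obtain ⟨N, hN⟩ := Metric.cauchySeq_iff.1 hcauchy (ε / (|C| + 1)) (by positivity)
    refine ⟨N, fun m hm n hn z hz => ?_⟩
    rw [dist_eq_norm]
    refine (hC' m n z hz).trans_lt ?_
    have := hN m hm n hn
    rw [dist_eq_norm, lt_div_iff₀ (by positivity)] at this
    linarith
  have hpt : ∀ z : ℂ, ∃ l, Tendsto (fun n => F n z) atTop (𝓝 l) := fun z =>
    cauchySeq_tendsto_of_complete ((hunif ‖z‖).cauchySeq (by simp))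
  choose G hG using hpt
  have hlu : TendstoLocallyUniformlyOn F G atTop Set.univ := by
    rw [tendstoLocallyUniformlyOn_univ]
    refine tendstoLocallyUniformly_of_forall_exists_nhds fun z => ?_
    exact ⟨Metric.closedBall 0 (‖z‖ + 1),
      Filter.mem_of_superset (Metric.ball_mem_nhds z one_pos) (fun w hw => by
        have h1 : ‖w - z‖ < 1 := by simpa [dist_eq_norm] using hw
        have h2 : ‖w‖ ≤ ‖w - z‖ + ‖z‖ := by simpa using norm_add_le (w - z) z
        rw [mem_closedBall_zero_iff]
        linarith),
      (hunif _).tendstoUniformlyOn_of_tendsto fun w _ => hG w⟩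
  have hGd : Differentiable ℂ G := by
    rw [← differentiableOn_univ]
    exact hlu.differentiableOn (Eventually.of_forall fun n => (hF n).differentiableOn) isOpen_univ
  refine ⟨G, hGd, ?_⟩
  obtain ⟨ns, hns, hae⟩ := (tendstoInMeasure_of_tendsto_Lp hfg).exists_seq_tendsto_ae
  have hall : ∀ᵐ z ∂gaussianMeasure, ∀ n, (f n : ℂ → ℂ) z = F n z := ae_all_iff.2 hfF
  filter_upwards [hae, hall] with z hz hzF
  refine tendsto_nhds_unique hz ?_
  simp only [hzF]
  exact (hG z).comp hns.tendsto_atTop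

instance : CompleteSpace fockSpace := isClosed_fockSpace.completeSpace_coe

/-! ### Toeplitz operators -/

theorem nullMeasurableSet_gaussianMeasure {Ω : Set ℂ} (hΩ : NullMeasurableSet Ω volume) :
    NullMeasurableSet Ω gaussianMeasure :=
  hΩ.mono_ac (withDensity_absolutelyContinuous _ _)

theorem memLp_indicator {Ω : Set ℂ} (hΩ : NullMeasurableSet Ω volume) (f : L2Gauss) :
    MemLp (Ω.indicator (f : ℂ → ℂ)) 2 gaussianMeasure :=
  ⟨(Lp.aestronglyMeasurable f).indicator₀ (nullMeasurableSet_gaussianMeasure hΩ),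
    (eLpNorm_indicator_le _).trans_lt (Lp.eLpNorm_lt_top f)⟩

/-- Multiplication by the characteristic function `χ_Ω` of a (Lebesgue) measurable set `Ω`, as a
bounded operator on `L²(ℂ, e^{-π|z|²} dA(z))`. -/
noncomputable def mulIndicator (Ω : Set ℂ) (hΩ : NullMeasurableSet Ω volume) :
    L2Gauss →L[ℂ] L2Gauss :=
  LinearMap.mkContinuous
    { toFun := fun f => (memLp_indicator hΩ f).toLp (Ω.indicator (f : ℂ → ℂ))
      map_add' := fun f g => by
        rw [← MemLp.toLp_add, MemLp.toLp_eq_toLp_iff]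
        filter_upwards [Lp.coeFn_add f g] with z hz
        by_cases h : z ∈ Ω
        · simp only [Pi.add_apply, Set.indicator_of_mem h, hz]
        · simp only [Pi.add_apply, Set.indicator_of_notMem h, add_zero]
      map_smul' := fun c f => by
        rw [RingHom.id_apply, ← MemLp.toLp_const_smul, MemLp.toLp_eq_toLp_iff]
        filter_upwards [Lp.coeFn_smul c f] with z hz
        by_cases h : z ∈ Ω
        · simp only [Pi.smul_apply, Set.indicator_of_mem h, hz]
        · simp only [Pi.smul_apply, Set.indicator_of_notMem h, smul_zero] }
    1 fun f => by
      rw [one_mul, LinearMap.coe_mk, AddHom.coe_mk, Lp.norm_toLp, Lp.norm_def]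
      exact ENNReal.toReal_mono (Lp.eLpNorm_ne_top f) (eLpNorm_indicator_le _)

/-- The Toeplitz (time-frequency localization) operator `T_Ω = P χ_Ω` on the Fock space, where `P`
is the orthogonal projection of `L²(ℂ, e^{-π|z|²} dA(z))` onto the Fock space. -/
noncomputable def toeplitz (Ω : Set ℂ) (hΩ : NullMeasurableSet Ω volume) :
    fockSpace →L[ℂ] fockSpace :=
  fockSpace.orthogonalProjectionOnto ∘L mulIndicator Ω hΩ ∘L fockSpace.subtypeL

/-! ### Schatten norms and circular symmetry -/

/-- For a compact positive operator `T` on a complex Hilbert space, the number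
`(∑ₖ λₖ ^ p) ^ (1 / p) ∈ [0, ∞]`, where `λ₁ ≥ λ₂ ≥ ⋯` are the positive eigenvalues of `T` repeated
according to multiplicity. The terms are nonnegative, so the sum does not depend on their order:
each real `t > 0` contributes `t ^ p` as many times as the dimension of `ker (T - t)`
(not at all, if `t` is not an eigenvalue). -/
noncomputable def schattenNorm {H : Type*} [NormedAddCommGroup H] [InnerProductSpace ℂ H]
    (p : ℝ) (T : H →L[ℂ] H) : ℝ≥0∞ :=
  (∑' t : Set.Ioi (0 : ℝ),
    (Module.finrank ℂ (Module.End.eigenspace (T : H →ₗ[ℂ] H) ((t : ℝ) : ℂ)) : ℝ≥0∞) *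
      ENNReal.ofReal (t : ℝ) ^ p) ^ (1 / p)

/-- `Ω` has, possibly after a translation, the form `{z | |z| ∈ E}` with `E` (Lebesgue)
measurable in the half-line `[0, ∞)`. -/
def IsCircularlySymmetric (Ω : Set ℂ) : Prop :=
  ∃ (w : ℂ) (E : Set ℝ), E ⊆ Set.Ici 0 ∧ NullMeasurableSet E volume ∧ Ω = {z | ‖z - w‖ ∈ E}

end FockToeplitz

open FockToeplitz

/-! Let `Ω` be radial about `w`. By rotation invariance, the normalized monomials translated to `w`
by the Weyl operators diagonalize `T_Ω`, with eigenvalues `∫_Ω t ^ k / k! * e ^ (-t) dA`, where `t =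
π |z - w|²`. The area coordinate `t` carries plane measure to Lebesgue measure on `[0, ∞)`, so the
eigenvalues are integrals of Poisson weights against a measure `m ≤ dt` of mass `|Ω|`; for the ball,
`m` is Lebesgue measure on `[0, |B|)`. The Poisson weights sum to 1, hence both eigenvalue sequences
have the same sum `|Ω| = |B|`.

The heart is a majorization (`sum_lintegral_poissonWeight_le`): any `N` eigenvalues of `T_Ω` sum to
at most the first `N` of `T_B`. Since `t ^ k / k! * e ^ (-t)` is the probability that a unit-rate
Poisson process is in state `k` at time `t`, the left side is the expected `m`-time spent in a set
`S` of `N` states. Condition on the first jump, at time `x`. If `0 ∈ S`, time `b = m [0, x) ≤ min x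
a` is collected, with `a` the total mass; then `N - 1` states and mass `a - b` remain. The inductive
bound is nondecreasing in `b`, because an extra amount of time raises an occupation time by at most
that amount; so `b = min x a` is the worst case, and it gives exactly the recursion for the
interval. If `0 ∉ S`, waiting only loses mass.

Majorization with equal finite sums gives the inequalities between power sums, as in Karamata's
inequality: `x ^ p` is a positive superposition of the functions `(x - s)₊` for `p > 1` and of `min
x s` for `0 < p < 1`. Finiteness for the ball holds because its eigenvalues decay geometrically. -/

namespace FockToeplitz

open scoped ComplexConjugate

/-! ### Occupation times of the Poisson process -/

/-- The Poisson weight `t ^ k / k! * e ^ (-t)`, extended by zero to `t < 0`. -/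
noncomputable def poissonWeight (k : ℕ) (t : ℝ) : ℝ≥0∞ :=
  (Set.Ici (0 : ℝ)).indicator (fun t => ENNReal.ofReal (t ^ k / k.factorial * Real.exp (-t))) t

theorem poissonWeight_of_nonneg (k : ℕ) {t : ℝ} (ht : 0 ≤ t) :
    poissonWeight k t = ENNReal.ofReal (t ^ k / k.factorial * Real.exp (-t)) :=
  Set.indicator_of_mem (Set.mem_Ici.2 ht) _

theorem poissonWeight_of_neg (k : ℕ) {t : ℝ} (ht : t < 0) : poissonWeight k t = 0 :=
  Set.indicator_of_notMem (by simpa using ht) _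

@[fun_prop]
theorem measurable_poissonWeight (k : ℕ) : Measurable (poissonWeight k) :=
  Measurable.indicator (by fun_prop) measurableSet_Ici

/-- The number of arrivals at time `u` is `k + 1` iff, with `x` the first arrival time, there are
`k` arrivals in the remaining time `u - x`. -/
theorem poissonWeight_succ (k : ℕ) (u : ℝ) :
    poissonWeight (k + 1) u =
      ∫⁻ x in Set.Ioi 0, ENNReal.ofReal (Real.exp (-x)) * poissonWeight k (u - x) := by
  rcases lt_or_ge u 0 with hu | hu
  · rw [poissonWeight_of_neg _ hu, eq_comm, lintegral_eq_zero_iff (by fun_prop)]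
    refine (ae_restrict_iff' measurableSet_Ioi).2 (Eventually.of_forall fun x hx => ?_)
    have hx : 0 < x := hx
    simp [poissonWeight_of_neg k (show u - x < 0 by linarith)]
  have h1 : ∫⁻ x in Set.Ioi 0, ENNReal.ofReal (Real.exp (-x)) * poissonWeight k (u - x) =
      ∫⁻ x in Set.Ioc 0 u,
        ENNReal.ofReal ((u - x) ^ k / k.factorial * Real.exp (-u)) := by
    rw [← lintegral_indicator measurableSet_Ioi, ← lintegral_indicator measurableSet_Ioc]
    refine lintegral_congr fun x => ?_
    by_cases hx : x ∈ Set.Ioc 0 u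
    · rw [Set.indicator_of_mem hx, Set.indicator_of_mem (Set.mem_Ioi.2 hx.1),
        poissonWeight_of_nonneg k (sub_nonneg.2 hx.2), ← ENNReal.ofReal_mul (by positivity)]
      congr 1
      rw [mul_left_comm, ← Real.exp_add]
      ring_nf
    · rw [Set.indicator_of_notMem hx]
      refine Set.indicator_apply_eq_zero.2 fun hx0 => ?_
      rw [poissonWeight_of_neg k, mul_zero]
      by_contra! h
      exact hx ⟨hx0, by linarith⟩
  rw [h1, poissonWeight_of_nonneg _ hu, ← ofReal_integral_eq_lintegral_ofReal]
  · congr 1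
    rw [← intervalIntegral.integral_of_le hu, intervalIntegral.integral_mul_const,
      intervalIntegral.integral_div,
      intervalIntegral.integral_comp_sub_left (fun x => x ^ k) u, integral_pow]
    simp only [sub_self, sub_zero, Nat.factorial_succ]
    push_cast
    field_simp
    ring
  · exact (Continuous.integrableOn_Icc (by fun_prop)).mono_set Set.Ioc_subset_Icc_self
  · refine (ae_restrict_iff' measurableSet_Ioc).2 (Eventually.of_forall fun x hx => ?_)
    have := sub_nonneg.2 hx.2
    simp only [Pi.zero_apply]
    positivity

theorem lintegral_exp_neg_Ioi (u : ℝ) :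
    ∫⁻ x in Set.Ioi u, ENNReal.ofReal (Real.exp (-x)) = ENNReal.ofReal (Real.exp (-u)) := by
  rw [← ofReal_integral_eq_lintegral_ofReal, integral_exp_neg_Ioi]
  · exact integrableOn_exp_neg_Ioi u
  · exact Eventually.of_forall fun x => (Real.exp_pos _).le

/-- There are no arrivals before time `u` iff the first arrival time exceeds `u`. -/
theorem poissonWeight_zero (u : ℝ) :
    poissonWeight 0 u =
      ∫⁻ x in Set.Ioi 0, ENNReal.ofReal (Real.exp (-x)) * (Set.Ico 0 x).indicator 1 u := by
  rcases lt_or_ge u 0 with hu | hu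
  · simp [poissonWeight_of_neg _ hu, hu.not_ge]
  have h1 : ∫⁻ x in Set.Ioi 0, ENNReal.ofReal (Real.exp (-x)) * (Set.Ico 0 x).indicator 1 u =
      ∫⁻ x in Set.Ioi u, ENNReal.ofReal (Real.exp (-x)) := by
    rw [← lintegral_indicator measurableSet_Ioi, ← lintegral_indicator measurableSet_Ioi]
    refine lintegral_congr fun x => ?_
    by_cases hx : u < x
    · have : 0 < x := hu.trans_lt hx
      simp [Set.indicator, hx, hu, this]
    · simp [Set.indicator, hx]
  rw [h1, poissonWeight_of_nonneg _ hu, lintegral_exp_neg_Ioi]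
  simp

theorem sum_poissonWeight_le_one (N : ℕ) (t : ℝ) :
    ∑ k ∈ Finset.range N, poissonWeight k t ≤ 1 := by
  rcases lt_or_ge t 0 with ht | ht
  · simp [poissonWeight_of_neg _ ht]
  simp only [poissonWeight_of_nonneg _ ht]
  rw [← ENNReal.ofReal_sum_of_nonneg (fun _ _ => by positivity), ← Finset.sum_mul,
    ENNReal.ofReal_le_one]
  calc _ ≤ Real.exp t * Real.exp (-t) := by
        gcongr
        exact Real.sum_le_exp_of_nonneg ht N
    _ = 1 := by rw [← Real.exp_add]; simp

theorem tsum_poissonWeight {t : ℝ} (ht : 0 ≤ t) : ∑' k, poissonWeight k t = 1 := by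
  simp only [poissonWeight_of_nonneg _ ht]
  have h : HasSum (fun k : ℕ => t ^ k / k.factorial * Real.exp (-t)) 1 := by
    have := (NormedSpace.expSeries_div_hasSum_exp t).mul_right (Real.exp (-t))
    rwa [← Real.exp_eq_exp_ℝ, ← Real.exp_add, add_neg_cancel, Real.exp_zero] at this
  rw [← ENNReal.ofReal_tsum_of_nonneg (fun _ => by positivity) h.summable, h.tsum_eq,
    ENNReal.ofReal_one]

/-- The expected time up to time `a` which a Poisson process spends in the states below `N`. -/
noncomputable def poissonTime (N : ℕ) (a : ℝ) : ℝ≥0∞ :=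
  ∑ k ∈ Finset.range N, ∫⁻ t in Set.Iio a, poissonWeight k t

theorem poissonTime_mono (N : ℕ) : Monotone (poissonTime N) := fun _ _ h =>
  Finset.sum_le_sum fun _ _ => lintegral_mono_set (Set.Iio_subset_Iio h)

/-- At each instant the state probabilities sum to at most 1, so the occupation time is 1-Lipschitz
in the horizon. This drives the comparison of first steps. -/
theorem poissonTime_add_le (N : ℕ) (a : ℝ) {b : ℝ} (hb : 0 ≤ b) :
    poissonTime N (a + b) ≤ poissonTime N a + ENNReal.ofReal b := by
  unfold poissonTime
  rw [← lintegral_finsetSum _ (fun _ _ => by fun_prop),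
    ← lintegral_finsetSum _ (fun _ _ => by fun_prop)]
  have : Set.Iio (a + b) = Set.Iio a ∪ Set.Ico a (a + b) := by
    rw [Set.Iio_union_Ico_eq_Iio (by linarith)]
  rw [this]
  refine (lintegral_union_le _ _ _).trans ?_
  gcongr
  calc _ ≤ ∫⁻ _ in Set.Ico a (a + b), 1 := lintegral_mono fun t => sum_poissonWeight_le_one N t
    _ = _ := by simp

/-- The shift `t - y` describes a process started at time `y`; after a first jump at `y + x` it
restarts there with the state index lowered by one. -/
theorem lintegral_poissonWeight_succ (m : Measure ℝ) [SFinite m] (k : ℕ) (y : ℝ) :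
    ∫⁻ t, poissonWeight (k + 1) (t - y) ∂m =
      ∫⁻ x in Set.Ioi 0, ENNReal.ofReal (Real.exp (-x)) *
        ∫⁻ t, poissonWeight k (t - (y + x)) ∂m := by
  simp only [poissonWeight_succ, sub_sub]
  rw [lintegral_lintegral_swap (by fun_prop)]
  refine lintegral_congr fun x => ?_
  rw [lintegral_const_mul _ (by fun_prop)]

theorem lintegral_poissonWeight_zero (m : Measure ℝ) [SFinite m] (y : ℝ) :
    ∫⁻ t, poissonWeight 0 (t - y) ∂m =
      ∫⁻ x in Set.Ioi 0, ENNReal.ofReal (Real.exp (-x)) * m (Set.Ico y (y + x)) := by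
  simp only [poissonWeight_zero]
  rw [lintegral_lintegral_swap]
  · refine lintegral_congr fun x => ?_
    rw [lintegral_const_mul' _ _ (by simp)]
    congr 1
    rw [← lintegral_indicator_one measurableSet_Ico]
    refine lintegral_congr fun t => ?_
    simp only [Set.indicator, Set.mem_Ico, sub_nonneg, sub_lt_iff_lt_add', Pi.one_apply]
  · refine Measurable.aemeasurable (Measurable.mul (by fun_prop) ?_)
    have : MeasurableSet {q : ℝ × ℝ | 0 ≤ q.1 - y ∧ q.1 - y < q.2} :=
      MeasurableSet.inter
        (measurableSet_le measurable_const (measurable_fst.sub_const y) :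
          MeasurableSet {q : ℝ × ℝ | 0 ≤ q.1 - y})
        (measurableSet_lt (measurable_fst.sub_const y) measurable_snd :
          MeasurableSet {q : ℝ × ℝ | q.1 - y < q.2})
    exact (measurable_one.indicator this : Measurable
      ({q : ℝ × ℝ | 0 ≤ q.1 - y ∧ q.1 - y < q.2}.indicator (1 : ℝ × ℝ → ℝ≥0∞)))

theorem measurable_lintegral_poissonWeight (m : Measure ℝ) [SFinite m] (k : ℕ) (y : ℝ) :
    Measurable fun x => ∫⁻ t, poissonWeight k (t - (y + x)) ∂m :=
  Measurable.lintegral_prod_right (by fun_prop)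

theorem sum_lintegral_poissonWeight_succ (m : Measure ℝ) [SFinite m] (T : Finset ℕ) (y : ℝ) :
    ∑ k ∈ T, ∫⁻ t, poissonWeight (k + 1) (t - y) ∂m =
      ∫⁻ x in Set.Ioi 0, ENNReal.ofReal (Real.exp (-x)) *
        ∑ k ∈ T, ∫⁻ t, poissonWeight k (t - (y + x)) ∂m := by
  simp only [Finset.mul_sum]
  rw [lintegral_finsetSum]
  · exact Finset.sum_congr rfl fun k _ => lintegral_poissonWeight_succ m k y
  · intro k _
    have := measurable_lintegral_poissonWeight m k y
    fun_prop

/-- Decomposition of the expected time spent in `{0} ∪ (T + 1)` at the first arrival time. -/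
theorem lintegral_poissonWeight_first_step (m : Measure ℝ) [SFinite m] (T : Finset ℕ) (y : ℝ) :
    ∫⁻ t, poissonWeight 0 (t - y) ∂m + ∑ k ∈ T, ∫⁻ t, poissonWeight (k + 1) (t - y) ∂m =
      ∫⁻ x in Set.Ioi 0, ENNReal.ofReal (Real.exp (-x)) *
        (m (Set.Ico y (y + x)) + ∑ k ∈ T, ∫⁻ t, poissonWeight k (t - (y + x)) ∂m) := by
  rw [sum_lintegral_poissonWeight_succ, lintegral_poissonWeight_zero, ← lintegral_add_right]
  · simp only [mul_add]
  · have := fun k => measurable_lintegral_poissonWeight m k y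
    fun_prop

theorem poissonTime_of_nonpos (N : ℕ) {a : ℝ} (ha : a ≤ 0) : poissonTime N a = 0 := by
  refine Finset.sum_eq_zero fun k _ => ?_
  rw [setLIntegral_eq_zero_iff measurableSet_Iio (by fun_prop)]
  exact Eventually.of_forall fun t ht => poissonWeight_of_neg k (lt_of_lt_of_le ht ha)

/-- First-step decomposition for Lebesgue measure below `a`: `min x a` is the time spent in state 0,
and after the jump the remaining horizon is `a - x`, which contributes nothing if negative. -/
theorem poissonTime_succ (N : ℕ) (a : ℝ) :
    poissonTime (N + 1) a =
      ∫⁻ x in Set.Ioi 0, ENNReal.ofReal (Real.exp (-x)) *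
        (ENNReal.ofReal (min x a) + poissonTime N (a - x)) := by
  have h := lintegral_poissonWeight_first_step (volume.restrict (Set.Iio a)) (Finset.range N) 0
  simp only [sub_zero, zero_add] at h
  rw [poissonTime, Finset.sum_range_succ', add_comm, h]
  refine lintegral_congr fun x => ?_
  congr 2
  · rw [Measure.restrict_apply measurableSet_Ico, Set.Ico_inter_Iio, Real.volume_Ico, sub_zero]
  · refine Finset.sum_congr rfl fun k _ => ?_
    rw [← lintegral_indicator measurableSet_Iio, ← lintegral_indicator measurableSet_Iio,
      ← lintegral_sub_right_eq_self ((Set.Iio (a - x)).indicator (poissonWeight k)) x]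
    refine lintegral_congr fun t => ?_
    simp [Set.indicator]

/-- By the Lipschitz bound, `b + poissonTime N (a - b)` is nondecreasing in `b`, so it is largest at
the extreme value `min x a`. -/
theorem poissonTime_le_succ_integrand (N : ℕ) {a b x : ℝ} (hbx : b ≤ x) (hba : b ≤ a)
    (hb : 0 ≤ b) :
    ENNReal.ofReal b + poissonTime N (a - b) ≤
      ENNReal.ofReal (min x a) + poissonTime N (a - x) := by
  have h0 : 0 ≤ min x a - b := sub_nonneg.2 (le_min hbx hba)
  have h1 : poissonTime N (a - min x a) ≤ poissonTime N (a - x) := by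
    rcases le_total x a with h | h
    · rw [min_eq_left h]
    · rw [min_eq_right h, sub_self, poissonTime_of_nonpos N le_rfl]
      exact zero_le
  calc ENNReal.ofReal b + poissonTime N (a - b)
      = ENNReal.ofReal b + poissonTime N (a - min x a + (min x a - b)) := by ring_nf
    _ ≤ ENNReal.ofReal b + (poissonTime N (a - x) + ENNReal.ofReal (min x a - b)) := by
        gcongr
        exact (poissonTime_add_le N _ h0).trans (by gcongr)
    _ = _ := by
        rw [add_left_comm, ← ENNReal.ofReal_add hb h0, add_sub_cancel, add_comm]

/-! ### The rearrangement inequality for occupation times -/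

theorem sum_eq_ite_add_sum_preimage_succ (f : ℕ → ℝ≥0∞) (S : Finset ℕ) :
    ∑ k ∈ S, f k = (if 0 ∈ S then f 0 else 0) +
      ∑ k ∈ S.preimage (· + 1) (add_left_injective 1).injOn, f (k + 1) := by
  classical
  rw [Finset.sum_preimage' (· + 1) S (add_left_injective 1).injOn f,
    ← Finset.sum_filter_add_sum_filter_not S (· = 0) f]
  congr 1
  · rw [Finset.filter_eq']
    split_ifs <;> simp
  · refine Finset.sum_congr (Finset.filter_congr fun k _ => ?_) fun _ _ => rfl
    cases k <;> simp

theorem card_eq_ite_add_card_preimage_succ (S : Finset ℕ) :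
    S.card = (if 0 ∈ S then 1 else 0) +
      (S.preimage (· + 1) (add_left_injective 1).injOn).card := by
  have h := sum_eq_ite_add_sum_preimage_succ (fun _ => 1) S
  simp only [Finset.sum_const, nsmul_eq_mul, mul_one] at h
  exact_mod_cast h

/-- Among all sets `S` of `N` states and all time sets (or densities `m ≤ 1`) of measure `a`, the
expected time which a Poisson process spends in `S` is largest for the first `N` states and the
time interval `[0, a)`. -/
theorem sum_lintegral_poissonWeight_le (m : Measure ℝ) [IsFiniteMeasure m] (hm : m ≤ volume)
    (S : Finset ℕ) (y : ℝ) :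
    ∑ k ∈ S, ∫⁻ t, poissonWeight k (t - y) ∂m ≤ poissonTime S.card (m.real (Set.Ici y)) := by
  -- Induction on a bound for the states, not on the cardinality: when `0 ∉ S` the shift by one
  -- keeps the cardinality but lowers the bound.
  obtain ⟨n, hn⟩ : ∃ n, ∀ k ∈ S, k < n :=
    ⟨S.sup id + 1, fun k hk => Nat.lt_succ_of_le (Finset.le_sup (f := id) hk)⟩
  induction n generalizing S y with
  | zero =>
    obtain rfl : S = ∅ := Finset.eq_empty_of_forall_notMem fun k hk => by simpa using hn k hk
    simp
  | succ n ih =>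
    set T := S.preimage (· + 1) (add_left_injective 1).injOn with hT
    have hTn : ∀ k ∈ T, k < n := fun k hk => by
      have := hn _ (Finset.mem_preimage.1 hk)
      omega
    rw [sum_eq_ite_add_sum_preimage_succ, card_eq_ite_add_card_preimage_succ S, ← hT]
    split_ifs with h0
    · rw [lintegral_poissonWeight_first_step, add_comm 1, poissonTime_succ]
      refine setLIntegral_mono' measurableSet_Ioi fun x hx => ?_
      have hx : 0 < x := hx
      gcongr _ * ?_
      have hsplit : m.real (Set.Ici y) =
          m.real (Set.Ico y (y + x)) + m.real (Set.Ici (y + x)) := by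
        rw [← measureReal_union _ measurableSet_Ici, Set.Ico_union_Ici_eq_Ici (by linarith)]
        exact Set.disjoint_left.2 fun t ht ht' => ht.2.not_ge ht'
      -- The density bound `m ≤ volume` enters here: no more than `x` can be collected before a jump
      -- after waiting time `x`.
      have hle : m.real (Set.Ico y (y + x)) ≤ x := by
        rw [measureReal_def]
        refine ENNReal.toReal_le_of_le_ofReal hx.le ((hm _).trans_eq ?_)
        rw [Real.volume_Ico, add_sub_cancel_left]
      have h2 := poissonTime_le_succ_integrand T.card hle
        (a := m.real (Set.Ici y)) (by linarith [measureReal_nonneg (μ := m) (s := Set.Ici (y + x))])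
        measureReal_nonneg
      refine le_trans ?_ h2
      rw [ofReal_measureReal, hsplit, add_sub_cancel_left]
      gcongr
      exact ih T _ hTn
    -- State 0 earns nothing, so the mass before the jump is discarded; the resulting bound no
    -- longer depends on `x`, and the exponential density has total mass 1.
    · rw [zero_add, zero_add, sum_lintegral_poissonWeight_succ]
      calc _ ≤ ∫⁻ x in Set.Ioi 0, ENNReal.ofReal (Real.exp (-x)) *
              poissonTime T.card (m.real (Set.Ici y)) := by
            refine setLIntegral_mono' measurableSet_Ioi fun x hx => ?_
            have hx : 0 < x := hx
            gcongr
            refine (ih T _ hTn).trans (poissonTime_mono _ (measureReal_mono ?_))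
            exact Set.Ici_subset_Ici.2 (by linarith)
        _ = _ := by
            rw [lintegral_mul_const _ (by fun_prop), lintegral_exp_neg_Ioi]
            simp

/-! ### Sums of powers under majorization -/

/-- Truncated subtraction cuts the integral off at `s = x`, leaving `x ^ p / (p - 1) - x ^ p / p`.
-/
theorem lintegral_rpow_mul_sub {p x : ℝ} (hp : 1 < p) (hx : 0 ≤ x) :
    ∫⁻ s in Set.Ioi (0 : ℝ), ENNReal.ofReal (s ^ (p - 2)) * (ENNReal.ofReal x - ENNReal.ofReal s) =
      ENNReal.ofReal (x ^ p / (p * (p - 1))) := by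
  have h1 : ∫⁻ s in Set.Ioi (0 : ℝ),
      ENNReal.ofReal (s ^ (p - 2)) * (ENNReal.ofReal x - ENNReal.ofReal s) =
      ∫⁻ s in Set.Ioc 0 x, ENNReal.ofReal (s ^ (p - 2) * x - s ^ (p - 1)) := by
    rw [← lintegral_indicator measurableSet_Ioi, ← lintegral_indicator measurableSet_Ioc]
    refine lintegral_congr fun s => ?_
    by_cases hs : s ∈ Set.Ioc 0 x
    · have hs0 : 0 < s := hs.1
      rw [Set.indicator_of_mem hs, Set.indicator_of_mem (Set.mem_Ioi.2 hs0),
        ← ENNReal.ofReal_sub _ hs0.le, ← ENNReal.ofReal_mul (by positivity), mul_sub]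
      congr 2
      rw [← Real.rpow_add_one hs0.ne']
      ring_nf
    · rw [Set.indicator_of_notMem hs]
      refine Set.indicator_apply_eq_zero.2 fun hs0 => ?_
      have h : x ≤ s := by
        by_contra! h
        exact hs ⟨hs0, h.le⟩
      rw [tsub_eq_zero_of_le (ENNReal.ofReal_le_ofReal h), mul_zero]
  have i1 : IntervalIntegrable (fun s : ℝ => s ^ (p - 2) * x) volume 0 x :=
    (intervalIntegral.intervalIntegrable_rpow' (by linarith)).mul_const _
  have i2 : IntervalIntegrable (fun s : ℝ => s ^ (p - 1)) volume 0 x :=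
    intervalIntegral.intervalIntegrable_rpow' (by linarith)
  rw [h1, ← ofReal_integral_eq_lintegral_ofReal]
  · congr 1
    rw [← intervalIntegral.integral_of_le hx, intervalIntegral.integral_sub i1 i2,
      intervalIntegral.integral_mul_const, integral_rpow (Or.inl (by linarith)),
      integral_rpow (Or.inl (by linarith)), Real.zero_rpow (by linarith),
      Real.zero_rpow (by linarith), show p - 2 + 1 = p - 1 by ring, sub_add_cancel]
    have e : x ^ (p - 1) * x = x ^ p := by
      rw [← Real.rpow_add_one' hx (by linarith), sub_add_cancel]
    have h3 : p - 1 ≠ 0 := by linarith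
    have h4 : p ≠ 0 := by linarith
    rw [sub_zero, sub_zero, div_mul_eq_mul_div, e]
    field_simp
    ring
  · exact ((intervalIntegrable_iff_integrableOn_Ioc_of_le hx).1 (i1.sub i2))
  · refine (ae_restrict_iff' measurableSet_Ioc).2 (Eventually.of_forall fun s hs => ?_)
    have hs0 : 0 < s := hs.1
    rw [Pi.zero_apply, sub_nonneg, show p - 1 = p - 2 + 1 by ring, Real.rpow_add_one hs0.ne']
    exact mul_le_mul_of_nonneg_left hs.2 (by positivity)

theorem lintegral_rpow_mul_min {p x : ℝ} (hp0 : 0 < p) (hp : p < 1) (hx : 0 ≤ x) :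
    ∫⁻ s in Set.Ioi (0 : ℝ),
        ENNReal.ofReal (s ^ (p - 2)) * min (ENNReal.ofReal x) (ENNReal.ofReal s) =
      ENNReal.ofReal (x ^ p / (p * (1 - p))) := by
  rcases hx.eq_or_lt with rfl | hx
  · simp [Real.zero_rpow hp0.ne']
  rw [← Set.Ioc_union_Ioi_eq_Ioi hx.le, lintegral_union measurableSet_Ioi
    (Set.disjoint_left.2 fun s hs hs' => hs.2.not_gt hs')]
  have h1 : ∫⁻ s in Set.Ioc 0 x,
      ENNReal.ofReal (s ^ (p - 2)) * min (ENNReal.ofReal x) (ENNReal.ofReal s) =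
      ENNReal.ofReal (x ^ p / p) := by
    have i1 : IntervalIntegrable (fun s : ℝ => s ^ (p - 1)) volume 0 x :=
      intervalIntegral.intervalIntegrable_rpow' (by linarith)
    calc _ = ∫⁻ s in Set.Ioc 0 x, ENNReal.ofReal (s ^ (p - 1)) := by
          refine setLIntegral_congr_fun measurableSet_Ioc fun s hs => ?_
          have hs0 : 0 < s := hs.1
          rw [min_eq_right (ENNReal.ofReal_le_ofReal hs.2), ← ENNReal.ofReal_mul (by positivity),
            ← Real.rpow_add_one hs0.ne']
          ring_nf
      _ = _ := by
          rw [← ofReal_integral_eq_lintegral_ofReal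
            ((intervalIntegrable_iff_integrableOn_Ioc_of_le hx.le).1 i1),
            ← intervalIntegral.integral_of_le hx.le, integral_rpow (Or.inl (by linarith)),
            Real.zero_rpow (by linarith), sub_zero, sub_add_cancel]
          refine (ae_restrict_iff' measurableSet_Ioc).2 (Eventually.of_forall fun s hs => ?_)
          have hs0 : 0 < s := hs.1
          simp only [Pi.zero_apply]
          positivity
  have h2 : ∫⁻ s in Set.Ioi x,
      ENNReal.ofReal (s ^ (p - 2)) * min (ENNReal.ofReal x) (ENNReal.ofReal s) =
      ENNReal.ofReal (x ^ p / (1 - p)) := by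
    calc _ = ∫⁻ s in Set.Ioi x, ENNReal.ofReal (s ^ (p - 2)) * ENNReal.ofReal x := by
          refine setLIntegral_congr_fun measurableSet_Ioi fun s hs => ?_
          rw [min_eq_left (ENNReal.ofReal_le_ofReal (le_of_lt hs))]
      _ = _ := by
          rw [lintegral_mul_const _ (by fun_prop), ← ofReal_integral_eq_lintegral_ofReal
            (integrableOn_Ioi_rpow_of_lt (by linarith) hx),
            integral_Ioi_rpow_of_lt (by linarith) hx, ← ENNReal.ofReal_mul' hx.le]
          · congr 1
            rw [show p - 2 + 1 = -(1 - p) by ring, neg_div_neg_eq, div_mul_eq_mul_div,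
              ← Real.rpow_add_one hx.ne']
            ring_nf
          · refine (ae_restrict_iff' measurableSet_Ioi).2 (Eventually.of_forall fun s hs => ?_)
            have hs0 : 0 < s := hx.trans hs
            simp only [Pi.zero_apply]
            positivity
  have h3 : 0 < 1 - p := by linarith
  rw [h1, h2, ← ENNReal.ofReal_add (by positivity) (by positivity)]
  congr 1
  field_simp
  ring

theorem rpow_eq_const_mul_lintegral_sub {p : ℝ} {x : ℝ≥0∞} (hp : 1 < p) (hx : x ≠ ∞) :
    x ^ p = ENNReal.ofReal (p * (p - 1)) *
      ∫⁻ s in Set.Ioi (0 : ℝ), ENNReal.ofReal (s ^ (p - 2)) * (x - ENNReal.ofReal s) := by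
  have h0 : 0 < p - 1 := by linarith
  obtain ⟨y, hy, rfl⟩ : ∃ y : ℝ, 0 ≤ y ∧ x = ENNReal.ofReal y :=
    ⟨x.toReal, ENNReal.toReal_nonneg, (ENNReal.ofReal_toReal hx).symm⟩
  rw [lintegral_rpow_mul_sub hp hy, ← ENNReal.ofReal_mul (by positivity),
    ENNReal.ofReal_rpow_of_nonneg hy (by linarith), mul_div_cancel₀ _ (by positivity)]

theorem rpow_eq_const_mul_lintegral_min {p : ℝ} {x : ℝ≥0∞} (hp0 : 0 < p) (hp : p < 1)
    (hx : x ≠ ∞) :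
    x ^ p = ENNReal.ofReal (p * (1 - p)) *
      ∫⁻ s in Set.Ioi (0 : ℝ), ENNReal.ofReal (s ^ (p - 2)) * min x (ENNReal.ofReal s) := by
  have h0 : 0 < 1 - p := by linarith
  obtain ⟨y, hy, rfl⟩ : ∃ y : ℝ, 0 ≤ y ∧ x = ENNReal.ofReal y :=
    ⟨x.toReal, ENNReal.toReal_nonneg, (ENNReal.ofReal_toReal hx).symm⟩
  rw [lintegral_rpow_mul_min hp0 hp hy, ← ENNReal.ofReal_mul (by positivity),
    ENNReal.ofReal_rpow_of_nonneg hy hp0.le, mul_div_cancel₀ _ (by positivity)]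

section Majorization

variable {u v : ℕ → ℝ≥0∞}

/-- Only indices with `u k ≥ s` contribute. If there are `N` of them, `∑ (u k - s) = ∑ u k - N s`,
which is at most the sum of the first `N` terms of `v` minus `N s`. -/
theorem tsum_tsub_le_of_majorized
    (hmaj : ∀ S : Finset ℕ, ∑ k ∈ S, u k ≤ ∑ k ∈ Finset.range S.card, v k)
    {s : ℝ≥0∞} (hs : s ≠ ∞) : ∑' k, (u k - s) ≤ ∑' k, (v k - s) := by
  classical
  rw [ENNReal.tsum_eq_iSup_sum]
  refine iSup_le fun F => ?_
  set S := F.filter (fun k => s ≤ u k) with hS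
  have h1 : ∑ k ∈ F, (u k - s) = ∑ k ∈ S, (u k - s) := by
    refine (Finset.sum_filter_of_ne fun k _ hk => ?_).symm
    by_contra! h
    exact hk (tsub_eq_zero_of_le h.le)
  have h2 : ∑ k ∈ S, (u k - s) + S.card * s = ∑ k ∈ S, u k := by
    rw [← nsmul_eq_mul, ← Finset.sum_const, ← Finset.sum_add_distrib]
    exact Finset.sum_congr rfl fun k hk => tsub_add_cancel_of_le (Finset.mem_filter.1 hk).2
  have h3 : ∑ k ∈ Finset.range S.card, v k ≤
      ∑ k ∈ Finset.range S.card, (v k - s) + S.card * s := by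
    nth_rewrite 3 [← Finset.card_range S.card]
    rw [← nsmul_eq_mul, ← Finset.sum_const, ← Finset.sum_add_distrib]
    exact Finset.sum_le_sum fun k _ => le_tsub_add
  have hfin : (S.card : ℝ≥0∞) * s ≠ ∞ := ENNReal.mul_ne_top (ENNReal.natCast_ne_top _) hs
  rw [h1]
  refine le_trans ?_ (ENNReal.sum_le_tsum (Finset.range S.card))
  refine (ENNReal.add_le_add_iff_right hfin).1 ?_
  rw [h2]
  exact (hmaj S).trans h3

/-- Since `min x s = x - (x - s)₊`, equal finite totals reverse the preceding inequality. -/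
theorem tsum_min_le_of_majorized
    (hmaj : ∀ S : Finset ℕ, ∑ k ∈ S, u k ≤ ∑ k ∈ Finset.range S.card, v k)
    (hsum : ∑' k, u k = ∑' k, v k) (hfin : ∑' k, v k ≠ ∞)
    {s : ℝ≥0∞} (hs : s ≠ ∞) : ∑' k, min (v k) s ≤ ∑' k, min (u k) s := by
  have h : ∀ w : ℕ → ℝ≥0∞, ∑' k, (w k - s) + ∑' k, min (w k) s = ∑' k, w k := fun w => by
    rw [← ENNReal.tsum_add]
    exact tsum_congr fun k => tsub_add_min
  have h1 : ∑' k, (v k - s) ≠ ∞ := ne_top_of_le_ne_top hfin ((h v).symm ▸ le_self_add)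
  refine (ENNReal.add_le_add_iff_left h1).1 ?_
  rw [h v, ← hsum, ← h u]
  gcongr ?_ + _
  exact tsum_tsub_le_of_majorized hmaj hs

theorem tsum_rpow_le_of_majorized
    (hmaj : ∀ S : Finset ℕ, ∑ k ∈ S, u k ≤ ∑ k ∈ Finset.range S.card, v k)
    (hsum : ∑' k, u k = ∑' k, v k) (hfin : ∑' k, v k ≠ ∞) {p : ℝ} (hp : 1 < p) :
    ∑' k, u k ^ p ≤ ∑' k, v k ^ p := by
  have hu : ∀ k, u k ≠ ∞ := ENNReal.ne_top_of_tsum_ne_top (hsum ▸ hfin)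
  have hv : ∀ k, v k ≠ ∞ := ENNReal.ne_top_of_tsum_ne_top hfin
  simp only [fun k => rpow_eq_const_mul_lintegral_sub hp (hu k),
    fun k => rpow_eq_const_mul_lintegral_sub hp (hv k)]
  rw [ENNReal.tsum_mul_left, ENNReal.tsum_mul_left, ← lintegral_tsum (fun _ => by fun_prop),
    ← lintegral_tsum (fun _ => by fun_prop)]
  simp only [ENNReal.tsum_mul_left]
  refine mul_le_mul_of_nonneg_left (lintegral_mono fun s => mul_le_mul_of_nonneg_left ?_ zero_le)
    zero_le
  exact tsum_tsub_le_of_majorized hmaj ENNReal.ofReal_ne_top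

theorem tsum_rpow_le_of_majorized_of_lt_one
    (hmaj : ∀ S : Finset ℕ, ∑ k ∈ S, u k ≤ ∑ k ∈ Finset.range S.card, v k)
    (hsum : ∑' k, u k = ∑' k, v k) (hfin : ∑' k, v k ≠ ∞) {p : ℝ} (hp0 : 0 < p) (hp : p < 1) :
    ∑' k, v k ^ p ≤ ∑' k, u k ^ p := by
  have hu : ∀ k, u k ≠ ∞ := ENNReal.ne_top_of_tsum_ne_top (hsum ▸ hfin)
  have hv : ∀ k, v k ≠ ∞ := ENNReal.ne_top_of_tsum_ne_top hfin
  simp only [fun k => rpow_eq_const_mul_lintegral_min hp0 hp (hu k),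
    fun k => rpow_eq_const_mul_lintegral_min hp0 hp (hv k)]
  rw [ENNReal.tsum_mul_left, ENNReal.tsum_mul_left, ← lintegral_tsum (fun _ => by fun_prop),
    ← lintegral_tsum (fun _ => by fun_prop)]
  simp only [ENNReal.tsum_mul_left]
  refine mul_le_mul_of_nonneg_left (lintegral_mono fun s => mul_le_mul_of_nonneg_left ?_ zero_le)
    zero_le
  exact tsum_min_le_of_majorized hmaj hsum hfin ENNReal.ofReal_ne_top

end Majorization

/-! ### Total mass and geometric decay of Poisson integrals -/

theorem tsum_lintegral_poissonWeight {m : Measure ℝ} (hm : m (Set.Iio 0) = 0) :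
    ∑' k, ∫⁻ t, poissonWeight k t ∂m = m Set.univ := by
  rw [← lintegral_tsum (fun _ => by fun_prop), ← lintegral_one]
  refine lintegral_congr_ae ?_
  have : ∀ᵐ t ∂m, t ∉ Set.Iio 0 := measure_eq_zero_iff_ae_notMem.1 hm
  filter_upwards [this] with t ht
  exact tsum_poissonWeight (by simpa using ht)

theorem lintegral_Iio_poissonWeight_le {a : ℝ} (ha : 0 ≤ a) (k : ℕ) :
    ∫⁻ t in Set.Iio a, poissonWeight k t ≤
      ENNReal.ofReal (a * Real.exp (2 * a)) * ENNReal.ofReal (1 / 2) ^ k := by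
  have hle : ∀ t ∈ Set.Ico 0 a,
      poissonWeight k t ≤ ENNReal.ofReal (Real.exp (2 * a) * (1 / 2) ^ k) := by
    intro t ht
    rw [poissonWeight_of_nonneg k ht.1]
    refine ENNReal.ofReal_le_ofReal ?_
    calc t ^ k / k.factorial * Real.exp (-t) ≤ a ^ k / k.factorial * 1 := by
          have := ht.1
          gcongr
          · exact ht.2.le
          · simpa using ht.1
      -- Doubling `a` buys the geometric factor; the rest is one term of the series of `exp (2 *
      -- a)`.
      _ = (2 * a) ^ k / k.factorial * (1 / 2) ^ k := by
          rw [mul_pow, one_div, inv_pow]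
          field_simp
      _ ≤ _ := by
          gcongr
          exact Real.pow_div_factorial_le_exp (2 * a) (by positivity) k
  rw [← Set.Iio_union_Ico_eq_Iio ha]
  refine (lintegral_union_le _ _ _).trans ?_
  rw [setLIntegral_eq_zero measurableSet_Iio fun t ht => poissonWeight_of_neg k ht, zero_add]
  refine (setLIntegral_mono' measurableSet_Ico hle).trans_eq ?_
  rw [setLIntegral_const, Real.volume_Ico, sub_zero, ← ENNReal.ofReal_mul (by positivity),
    ← ENNReal.ofReal_pow (by positivity), ← ENNReal.ofReal_mul (by positivity)]
  ring_nf

theorem tsum_lintegral_Iio_poissonWeight_rpow_lt_top {a : ℝ} (ha : 0 ≤ a) {p : ℝ} (hp : 0 < p) :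
    ∑' k, (∫⁻ t in Set.Iio a, poissonWeight k t) ^ p < ∞ := by
  set c := ENNReal.ofReal (a * Real.exp (2 * a)) with hc
  set q : ℝ≥0∞ := ENNReal.ofReal (1 / 2) ^ p with hq
  have hq1 : q < 1 := ENNReal.rpow_lt_one (by norm_num) hp
  calc _ ≤ ∑' k, c ^ p * q ^ k := by
        refine ENNReal.tsum_le_tsum fun k => ?_
        calc _ ≤ (c * ENNReal.ofReal (1 / 2) ^ k) ^ p :=
              ENNReal.rpow_le_rpow (lintegral_Iio_poissonWeight_le ha k) hp.le
          _ = _ := by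
              rw [ENNReal.mul_rpow_of_nonneg _ _ hp.le, hq, ← ENNReal.rpow_natCast,
                ← ENNReal.rpow_natCast, ← ENNReal.rpow_mul, ← ENNReal.rpow_mul, mul_comm p]
    _ < ∞ := by
        rw [ENNReal.tsum_mul_left, ENNReal.tsum_geometric]
        refine ENNReal.mul_lt_top (ENNReal.rpow_lt_top_of_nonneg hp.le ENNReal.ofReal_ne_top) ?_
        exact ENNReal.inv_lt_top.2 (tsub_pos_of_lt hq1)

/-! ### Schatten norms of diagonal operators -/

section Diagonal

variable {H : Type*} [NormedAddCommGroup H] [InnerProductSpace ℂ H]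

/-- Expand `x` in the basis and apply the continuous maps `T` and `⟪b k, ·⟫` termwise. -/
theorem inner_apply_of_diagonal (b : HilbertBasis ℕ ℂ H) (T : H →L[ℂ] H) {lam : ℕ → ℝ}
    (hT : ∀ k, T (b k) = (lam k : ℂ) • b k) (x : H) (k : ℕ) :
    inner ℂ (b k) (T x) = lam k * inner ℂ (b k) x := by
  have h1 := ((b.hasSum_repr x).mapL T).mapL (innerSL ℂ (b k))
  have hb := orthonormal_iff_ite.1 b.orthonormal
  simp only [map_smul, hT, innerSL_apply_apply, hb, smul_eq_mul, b.repr_apply_apply] at h1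
  have h2 := h1.unique (hasSum_single k fun j hj => by simp [hj.symm])
  rw [h2]
  simp [mul_comm]

theorem finrank_eigenspace_of_diagonal (b : HilbertBasis ℕ ℂ H) (T : H →L[ℂ] H) {lam : ℕ → ℝ}
    (hT : ∀ k, T (b k) = (lam k : ℂ) • b k) (t : ℝ) (F : Finset ℕ)
    (hF : ∀ k, k ∈ F ↔ lam k = t) :
    Module.finrank ℂ (Module.End.eigenspace (T : H →ₗ[ℂ] H) (t : ℂ)) = F.card := by
  have h : Module.End.eigenspace (T : H →ₗ[ℂ] H) (t : ℂ) =
      Submodule.span ℂ (Set.range fun k : F => b k) := by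
    refine le_antisymm (fun x hx => ?_) (Submodule.span_le.2 ?_)
    · have hx' : T x = (t : ℂ) • x := Module.End.mem_eigenspace_iff.1 hx
      have hz : ∀ k ∉ F, b.repr x k • b k = 0 := by
        intro k hk
        have h1 := inner_apply_of_diagonal b T hT x k
        rw [hx', inner_smul_right] at h1
        have h2 : (t : ℂ) ≠ lam k := fun h => hk ((hF k).2 (by exact_mod_cast h.symm))
        rw [b.repr_apply_apply]
        rcases mul_eq_mul_right_iff.1 h1 with h3 | h3
        · exact absurd h3 h2
        · rw [h3, zero_smul]
      rw [(b.hasSum_repr x).unique (hasSum_sum_of_ne_finset_zero hz)]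
      exact Submodule.sum_mem _ fun k hk =>
        Submodule.smul_mem _ _ (Submodule.subset_span ⟨⟨k, hk⟩, rfl⟩)
    · rintro _ ⟨k, rfl⟩
      refine Module.End.mem_eigenspace_iff.2 ?_
      rw [← (hF k).1 k.2]
      exact hT k
  rw [h]
  exact (finrank_span_eq_card
    (b.orthonormal.linearIndependent.comp _ Subtype.val_injective)).trans (Fintype.card_coe F)

/-- Interchange the sums over `t` and `k`: each `k` with `lam k > 0` is counted at exactly one `t`.
Finite level sets matter because `finrank` is 0 in infinite dimension. -/
theorem schattenNorm_of_diagonal (b : HilbertBasis ℕ ℂ H) (T : H →L[ℂ] H) {lam : ℕ → ℝ}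
    (hT : ∀ k, T (b k) = (lam k : ℂ) • b k) (hfin : ∀ t, 0 < t → {k | lam k = t}.Finite)
    {p : ℝ} (hp : 0 < p) :
    schattenNorm p T = (∑' k, ENNReal.ofReal (lam k) ^ p) ^ (1 / p) := by
  unfold schattenNorm
  congr 1
  have h1 : ∀ t : Set.Ioi (0 : ℝ),
      (Module.finrank ℂ (Module.End.eigenspace (T : H →ₗ[ℂ] H) ((t : ℝ) : ℂ)) : ℝ≥0∞) *
        ENNReal.ofReal (t : ℝ) ^ p =
      ∑' k, if lam k = t then ENNReal.ofReal (lam k) ^ p else 0 := by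
    intro t
    have hF : ∀ k, k ∈ (hfin t t.2).toFinset ↔ lam k = t := fun k => by simp
    rw [finrank_eigenspace_of_diagonal b T hT t _ hF,
      tsum_eq_sum (s := (hfin t t.2).toFinset) fun k hk => if_neg fun h => hk ((hF k).2 h),
      ← nsmul_eq_mul, ← Finset.sum_const]
    exact Finset.sum_congr rfl fun k hk => by rw [if_pos ((hF k).1 hk), (hF k).1 hk]
  simp only [h1]
  rw [ENNReal.tsum_comm]
  refine tsum_congr fun k => ?_
  by_cases hk : 0 < lam k
  · rw [tsum_eq_single ⟨lam k, hk⟩, if_pos rfl]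
    exact fun t ht => if_neg fun h => ht (Subtype.ext h.symm)
  · rw [ENNReal.ofReal_of_nonpos (not_lt.1 hk), ENNReal.zero_rpow_of_pos hp]
    simp

end Diagonal

/-! ### Lebesgue measure on the plane and the area coordinate `π |z - w|²` -/

theorem preimage_area_Iio (w : ℂ) (a : ℝ) :
    (fun z : ℂ => Real.pi * ‖z - w‖ ^ 2) ⁻¹' Set.Iio a = Metric.ball w (Real.sqrt (a / Real.pi)) := by
  ext z
  rw [Set.mem_preimage, Set.mem_Iio, Metric.mem_ball, dist_eq_norm,
    Real.lt_sqrt (norm_nonneg _), lt_div_iff₀' Real.pi_pos]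

theorem volume_preimage_area_Iio (w : ℂ) (a : ℝ) :
    volume ((fun z : ℂ => Real.pi * ‖z - w‖ ^ 2) ⁻¹' Set.Iio a) = ENNReal.ofReal a := by
  rw [preimage_area_Iio, Complex.volume_ball]
  rcases le_total a 0 with h | h
  · rw [Real.sqrt_eq_zero_of_nonpos (div_nonpos_of_nonpos_of_nonneg h Real.pi_pos.le),
      ENNReal.ofReal_of_nonpos h]
    simp
  · rw [← ENNReal.ofReal_pow (Real.sqrt_nonneg _), Real.sq_sqrt (by positivity),
      show (NNReal.pi : ℝ≥0∞) = ENNReal.ofReal Real.pi from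
        (ENNReal.ofReal_coe_nnreal (p := NNReal.pi)).symm,
      ← ENNReal.ofReal_mul (by positivity), div_mul_cancel₀ _ Real.pi_ne_zero]

theorem measurable_area (w : ℂ) : Measurable fun z : ℂ => Real.pi * ‖z - w‖ ^ 2 := by fun_prop

/-- The disc `{π |z - w|² < a}` has area `a` for `a ≥ 0` and is empty for `a ≤ 0`; half-open
intervals determine the measure. -/
theorem map_area_volume (w : ℂ) :
    (volume : Measure ℂ).map (fun z => Real.pi * ‖z - w‖ ^ 2) =
      volume.restrict (Set.Ici (0 : ℝ)) := by
  refine (Measure.ext_of_Ico _ _ fun a b hab => ?_).symm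
  have hI : Set.Ico a b = Set.Iio b \ Set.Iio a := by
    ext t
    simp
  rw [Measure.map_apply (measurable_area w) measurableSet_Ico,
    Measure.restrict_apply measurableSet_Ico, hI, Set.preimage_sdiff,
    measure_sdiff (Set.preimage_mono (Set.Iio_subset_Iio hab.le))
      ((measurable_area w) measurableSet_Iio).nullMeasurableSet
      (by simp [volume_preimage_area_Iio]),
    volume_preimage_area_Iio, volume_preimage_area_Iio]
  have : (Set.Iio b \ Set.Iio a) ∩ Set.Ici 0 = Set.Ico (max a 0) b := by
    ext t
    simp only [Set.mem_inter_iff, Set.mem_sdiff, Set.mem_Iio, not_lt, Set.mem_Ici, Set.mem_Ico,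
      sup_le_iff]
    tauto
  rw [this, Real.volume_Ico]
  rcases le_total a 0 with h | h
  · simp [h, ENNReal.ofReal_of_nonpos]
  · rw [max_eq_left h, ENNReal.ofReal_sub _ h]

/-! ### The monomial basis of the Fock space, centred at a point -/

/-- The function `(π ^ k / k!) ^ (1 / 2) (z - w) ^ k e ^ (π conj w z - π |w|² / 2)`, the image of
the normalized monomial of degree `k` under the Weyl translation by `w`. -/
noncomputable def fockFun (w : ℂ) (k : ℕ) (z : ℂ) : ℂ :=
  (Real.sqrt (Real.pi ^ k / k.factorial) : ℂ) * (z - w) ^ k *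
    Complex.exp (Real.pi * conj w * z - Real.pi * ‖w‖ ^ 2 / 2)

theorem differentiable_fockFun (w : ℂ) (k : ℕ) : Differentiable ℂ (fockFun w k) := by
  unfold fockFun
  fun_prop

@[fun_prop]
theorem continuous_fockFun (w : ℂ) (k : ℕ) : Continuous (fockFun w k) :=
  (differentiable_fockFun w k).continuous

/-- The Weyl factor completes the square, turning the Gaussian centred at 0 into the one centred at
`w`. -/
theorem exp_mul_conj_fockFun_mul (w : ℂ) (j k : ℕ) (z : ℂ) :
    (Real.exp (-Real.pi * ‖z‖ ^ 2) : ℂ) * (conj (fockFun w j z) * fockFun w k z) =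
      (Real.sqrt (Real.pi ^ j / j.factorial) : ℂ) * (Real.sqrt (Real.pi ^ k / k.factorial) : ℂ) *
        (conj (z - w) ^ j * (z - w) ^ k) * (Real.exp (-Real.pi * ‖z - w‖ ^ 2) : ℂ) := by
  have h : Complex.exp (-Real.pi * ‖z - w‖ ^ 2) =
      Complex.exp (-Real.pi * ‖z‖ ^ 2) *
        (conj (Complex.exp (Real.pi * conj w * z - Real.pi * ‖w‖ ^ 2 / 2)) *
          Complex.exp (Real.pi * conj w * z - Real.pi * ‖w‖ ^ 2 / 2)) := by
    rw [← Complex.exp_conj, ← Complex.exp_add, ← Complex.exp_add]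
    congr 1
    simp only [map_sub, map_mul, map_div₀, Complex.conj_conj, Complex.conj_ofReal,
      Complex.conj_ofNat, ← Complex.conj_mul']
    ring
  push_cast
  rw [h]
  simp only [fockFun, map_mul, map_pow, Complex.conj_ofReal]
  ring

theorem exp_mul_conj_fockFun_mul_self (w : ℂ) (k : ℕ) (z : ℂ) :
    (Real.exp (-Real.pi * ‖z‖ ^ 2) : ℂ) * (conj (fockFun w k z) * fockFun w k z) =
      ((poissonWeight k (Real.pi * ‖z - w‖ ^ 2)).toReal : ℂ) := by
  rw [exp_mul_conj_fockFun_mul, poissonWeight_of_nonneg _ (by positivity),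
    ENNReal.toReal_ofReal (by positivity), ← mul_pow, Complex.conj_mul', ← Complex.ofReal_mul,
    Real.mul_self_sqrt (by positivity)]
  push_cast
  ring_nf

theorem poissonWeight_ne_top (k : ℕ) (t : ℝ) : poissonWeight k t ≠ ∞ := by
  unfold poissonWeight Set.indicator
  split_ifs <;> simp

theorem lintegral_poissonWeight (k : ℕ) : ∫⁻ t in Set.Ici 0, poissonWeight k t = 1 := by
  rw [setLIntegral_congr_fun measurableSet_Ici fun t ht => poissonWeight_of_nonneg k ht,
    ← setLIntegral_congr Ioi_ae_eq_Ici, ← ofReal_integral_eq_lintegral_ofReal]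
  · have h := Real.Gamma_eq_integral (s := k + 1) (by positivity)
    have h2 : ∫ t in Set.Ioi (0 : ℝ), t ^ k / k.factorial * Real.exp (-t) =
        (∫ t in Set.Ioi (0 : ℝ), Real.exp (-t) * t ^ ((k : ℝ) + 1 - 1)) / k.factorial := by
      rw [← integral_div]
      refine setIntegral_congr_fun measurableSet_Ioi fun t _ => ?_
      simp only [add_sub_cancel_right, Real.rpow_natCast]
      ring
    rw [h2, ← h, Real.Gamma_nat_eq_factorial, div_self (by positivity), ENNReal.ofReal_one]
  · have h := (Real.GammaIntegral_convergent (s := k + 1) (by positivity)).div_const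
      (k.factorial : ℝ)
    refine h.congr (Eventually.of_forall fun t => ?_)
    simp only [add_sub_cancel_right, Real.rpow_natCast]
    ring
  · refine (ae_restrict_iff' measurableSet_Ioi).2 (Eventually.of_forall fun t ht => ?_)
    have ht0 : 0 < t := ht
    simp only [Pi.zero_apply]
    positivity

theorem lintegral_poissonWeight_area (w : ℂ) (k : ℕ) :
    ∫⁻ z : ℂ, poissonWeight k (Real.pi * ‖z - w‖ ^ 2) = 1 := by
  rw [← lintegral_map (f := poissonWeight k) (by fun_prop) (measurable_area w), map_area_volume,
    lintegral_poissonWeight]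

theorem integral_gaussianMeasure (g : ℂ → ℂ) :
    ∫ z, g z ∂gaussianMeasure = ∫ z, (Real.exp (-Real.pi * ‖z‖ ^ 2) : ℂ) * g z := by
  rw [gaussianMeasure, integral_withDensity_eq_integral_toReal_smul (by fun_prop) (by simp)]
  refine integral_congr_ae (Eventually.of_forall fun z => ?_)
  simp [ENNReal.toReal_ofReal (Real.exp_pos _).le]

theorem integrable_gaussianMeasure_iff (g : ℂ → ℂ) :
    Integrable g gaussianMeasure ↔
      Integrable fun z => (Real.exp (-Real.pi * ‖z‖ ^ 2) : ℂ) * g z := by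
  rw [gaussianMeasure, integrable_withDensity_iff_integrable_smul' (by fun_prop) (by simp)]
  refine integrable_congr (Eventually.of_forall fun z => ?_)
  simp [ENNReal.toReal_ofReal (Real.exp_pos _).le]

theorem memLp_fockFun (w : ℂ) (k : ℕ) : MemLp (fockFun w k) 2 gaussianMeasure := by
  rw [memLp_two_iff_integrable_sq_norm (continuous_fockFun w k).aestronglyMeasurable]
  have h : Integrable (fun z => ((poissonWeight k (Real.pi * ‖z - w‖ ^ 2)).toReal : ℂ)) volume := by
    refine (integrable_toReal_of_lintegral_ne_top ?_ ?_).ofReal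
    · exact ((measurable_poissonWeight k).comp (measurable_area w)).aemeasurable
    · rw [lintegral_poissonWeight_area]
      exact ENNReal.one_ne_top
  simp only [← exp_mul_conj_fockFun_mul_self] at h
  rw [← integrable_gaussianMeasure_iff] at h
  refine h.re.congr (Eventually.of_forall fun z => ?_)
  simp only [Complex.conj_mul', RCLike.re_to_complex]
  norm_cast

/-- The monomial of degree `k` centred at `w`, as an element of the Fock space. -/
noncomputable def fockVec (w : ℂ) (k : ℕ) : fockSpace :=
  ⟨(memLp_fockFun w k).toLp _, fockFun w k, differentiable_fockFun w k,
    (memLp_fockFun w k).coeFn_toLp⟩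

theorem coeFn_fockVec (w : ℂ) (k : ℕ) :
    ((fockVec w k : L2Gauss) : ℂ → ℂ) =ᵐ[gaussianMeasure] fockFun w k :=
  (memLp_fockFun w k).coeFn_toLp

theorem integral_comp_mul_left_of_norm_one (J : ℂ → ℂ) {ζ : ℂ} (hζ : ‖ζ‖ = 1) :
    ∫ z, J (ζ * z) = ∫ z, J z := by
  have h := (rotation (⟨ζ, by simpa [Submonoid.unitSphere] using hζ⟩ : Circle)).measurePreserving
  exact h.integral_comp (LinearIsometryEquiv.toHomeomorph (rotation _)).measurableEmbedding J

theorem integral_eq_zero_of_rotation {J : ℂ → ℂ} {j k : ℕ} (hjk : j ≠ k)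
    (hJ : ∀ ζ z : ℂ, ‖ζ‖ = 1 → J (ζ * z) = conj ζ ^ j * ζ ^ k * J z) : ∫ z, J z = 0 := by
  have hd : (k : ℂ) - j ≠ 0 := sub_ne_zero.2 (by exact_mod_cast hjk.symm)
  -- With this angle the rotation factor `e ^ (i (k - j) θ)` is `-1`, so the integral equals its
  -- negative.
  set θ : ℝ := Real.pi / (k - j) with hθ
  set ζ : ℂ := Complex.exp (θ * Complex.I) with hζ
  have h1 : ‖ζ‖ = 1 := Complex.norm_exp_ofReal_mul_I θ
  have h2 : conj ζ ^ j * ζ ^ k = -1 := by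
    rw [hζ, ← Complex.exp_conj, ← Complex.exp_nat_mul, ← Complex.exp_nat_mul, ← Complex.exp_add,
      ← Complex.exp_pi_mul_I]
    congr 1
    simp only [map_mul, Complex.conj_ofReal, Complex.conj_I, hθ]
    push_cast
    field_simp
    ring
  have h3 := integral_comp_mul_left_of_norm_one J h1
  simp only [hJ ζ _ h1, h2, neg_mul, one_mul, integral_neg] at h3
  exact self_eq_neg.1 h3.symm

/-- The matrix coefficients of `χ_Ω` in the monomial basis centred at `w`, for `Ω` radial about
`w`. -/
theorem setIntegral_conj_fockFun_mul {Ω : Set ℂ} (hΩ : NullMeasurableSet Ω volume) {w : ℂ}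
    {E : Set ℝ} (hE : Ω = {z | ‖z - w‖ ∈ E}) (j k : ℕ) :
    ∫ z in Ω, conj (fockFun w j z) * fockFun w k z ∂gaussianMeasure =
      if j = k then
        ((∫⁻ z in Ω, poissonWeight k (Real.pi * ‖z - w‖ ^ 2)).toReal : ℂ) else 0 := by
  rw [← integral_indicator₀ (nullMeasurableSet_gaussianMeasure hΩ), integral_gaussianMeasure]
  have hind : ∀ z, (Real.exp (-Real.pi * ‖z‖ ^ 2) : ℂ) *
      Ω.indicator (fun z => conj (fockFun w j z) * fockFun w k z) z =
      Ω.indicator (fun z => (Real.exp (-Real.pi * ‖z‖ ^ 2) : ℂ) *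
        (conj (fockFun w j z) * fockFun w k z)) z := fun z => by
    by_cases hz : z ∈ Ω <;> simp [hz]
  simp only [hind]
  split_ifs with hjk
  · subst hjk
    rw [integral_indicator₀ hΩ]
    simp only [exp_mul_conj_fockFun_mul_self]
    rw [integral_complex_ofReal, integral_toReal]
    · exact ((measurable_poissonWeight j).comp (measurable_area w)).aemeasurable
    · exact Eventually.of_forall fun z => (poissonWeight_ne_top _ _).lt_top
  · rw [← integral_add_right_eq_self _ w]
    refine integral_eq_zero_of_rotation hjk fun ζ z hζ => ?_
    have hmem : ζ * z + w ∈ Ω ↔ z + w ∈ Ω := by simp [hE, hζ]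
    by_cases hz : z + w ∈ Ω
    · rw [Set.indicator_of_mem hz, Set.indicator_of_mem (hmem.2 hz), exp_mul_conj_fockFun_mul,
        exp_mul_conj_fockFun_mul]
      simp only [add_sub_cancel_right, norm_mul, hζ, one_mul, map_mul]
      ring
    · rw [Set.indicator_of_notMem hz, Set.indicator_of_notMem (fun h => hz (hmem.1 h)), mul_zero]

theorem inner_fockVec_mulIndicator {Ω : Set ℂ} (hΩ : NullMeasurableSet Ω volume) {w : ℂ}
    {E : Set ℝ} (hE : Ω = {z | ‖z - w‖ ∈ E}) (j k : ℕ) :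
    inner ℂ (fockVec w j : L2Gauss) (mulIndicator Ω hΩ (fockVec w k : L2Gauss)) =
      if j = k then
        ((∫⁻ z in Ω, poissonWeight k (Real.pi * ‖z - w‖ ^ 2)).toReal : ℂ) else 0 := by
  rw [← setIntegral_conj_fockFun_mul hΩ hE, L2.inner_def,
    ← integral_indicator₀ (nullMeasurableSet_gaussianMeasure hΩ)]
  refine integral_congr_ae ?_
  have h : (mulIndicator Ω hΩ (fockVec w k : L2Gauss) : ℂ → ℂ) =ᵐ[gaussianMeasure]
      Ω.indicator ((fockVec w k : L2Gauss) : ℂ → ℂ) :=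
    MemLp.coeFn_toLp (memLp_indicator hΩ _)
  filter_upwards [h, coeFn_fockVec w j, coeFn_fockVec w k] with z h1 h2 h3
  rw [h1, h2]
  by_cases hz : z ∈ Ω
  · simp [hz, h3, mul_comm]
  · simp [hz]

theorem mulIndicator_univ (f : L2Gauss) : mulIndicator Set.univ nullMeasurableSet_univ f = f := by
  refine Lp.ext ?_
  have h : (mulIndicator Set.univ nullMeasurableSet_univ f : ℂ → ℂ) =ᵐ[gaussianMeasure]
      Set.univ.indicator (f : ℂ → ℂ) := MemLp.coeFn_toLp (memLp_indicator nullMeasurableSet_univ f)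
  rwa [Set.indicator_univ] at h

/-- This is the case `Ω = ℂ` of the matrix coefficients of `χ_Ω`. -/
theorem orthonormal_fockVec (w : ℂ) : Orthonormal ℂ (fockVec w) := by
  rw [orthonormal_iff_ite]
  intro j k
  have h := inner_fockVec_mulIndicator nullMeasurableSet_univ (w := w) (E := Set.univ)
    (by simp) j k
  rw [mulIndicator_univ] at h
  rw [Submodule.coe_inner, h, Measure.restrict_univ, lintegral_poissonWeight_area]
  simp

/-! ### Completeness of the monomials -/

/-- Cauchy's formula for the `n`-th derivative at 0 of `u ↦ G (u * z)`, on the unit circle. -/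
theorem integral_conj_pow_mul_circle {G : ℂ → ℂ} (hG : Differentiable ℂ G) (n : ℕ) (z : ℂ) :
    ∫ θ in (0 : ℝ)..2 * Real.pi,
        conj (Complex.exp (θ * Complex.I)) ^ n * G (Complex.exp (θ * Complex.I) * z) =
      2 * Real.pi / n.factorial * (z ^ n * iteratedDeriv n G 0) := by
  have hGz : Differentiable ℂ fun u => G (u * z) := by fun_prop
  have h := hGz.differentiableOn.circleIntegral_one_div_sub_center_pow_smul one_pos n
    (c := 0)
  have hd : iteratedDeriv n (fun u => G (u * z)) 0 = z ^ n * iteratedDeriv n G 0 := by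
    have := iteratedDeriv_comp_const_mul (n := n) (f := G) hG.contDiff z
    simp only [mul_comm z] at this
    rw [this]
    simp
  rw [hd, circleIntegral] at h
  have hI : Complex.I ≠ 0 := Complex.I_ne_zero
  refine mul_left_cancel₀ hI ?_
  rw [← intervalIntegral.integral_const_mul]
  calc _ = _ := by
        refine intervalIntegral.integral_congr fun θ _ => ?_
        rw [← Complex.exp_conj]
        simp only [deriv_circleMap, circleMap, Complex.ofReal_one, one_mul, zero_add, sub_zero,
          smul_eq_mul, map_mul, Complex.conj_ofReal, Complex.conj_I, mul_neg, Complex.exp_neg,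
          one_div, pow_succ, inv_pow]
        have := Complex.exp_ne_zero (θ * Complex.I)
        field_simp
    _ = _ := h
    _ = _ := by
        rw [smul_eq_mul]
        ring

/-- Averaging the integrand over rotations keeps its integral 0, while by Cauchy's formula the
average is the `n`-th Taylor coefficient times a positive multiple of `|z| ^ (2 n) e ^ (-π |z|²)`,
whose integral is nonzero. Thus Fubini replaces termwise integration of a power series. -/
theorem iteratedDeriv_eq_zero_of_integral_eq_zero {G : ℂ → ℂ} (hG : Differentiable ℂ G) (n : ℕ)
    (hint : Integrable fun z : ℂ => conj z ^ n * G z * (Real.exp (-Real.pi * ‖z‖ ^ 2) : ℂ))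
    (h0 : ∫ z : ℂ, conj z ^ n * G z * (Real.exp (-Real.pi * ‖z‖ ^ 2) : ℂ) = 0) :
    iteratedDeriv n G 0 = 0 := by
  set K : ℂ → ℂ := fun z => conj z ^ n * G z * (Real.exp (-Real.pi * ‖z‖ ^ 2) : ℂ) with hK
  have hKc : Continuous K := by
    have := hG.continuous
    fun_prop
  have hnorm : ∀ θ : ℝ, ‖Complex.exp (θ * Complex.I)‖ = 1 := Complex.norm_exp_ofReal_mul_I
  set ν := (volume : Measure ℝ).restrict (Set.Ioc 0 (2 * Real.pi)) with hν
  have hprod : Integrable (Function.uncurry fun (θ : ℝ) (z : ℂ) =>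
      K (Complex.exp (θ * Complex.I) * z)) (ν.prod volume) := by
    rw [integrable_prod_iff (Continuous.aestronglyMeasurable (by
      simp only [Function.uncurry_def]; fun_prop))]
    constructor
    · refine Eventually.of_forall fun θ => ?_
      have h := (rotation (Circle.exp θ)).measurePreserving
      have h2 := (h.integrable_comp_emb
        (LinearIsometryEquiv.toHomeomorph (rotation (Circle.exp θ))).measurableEmbedding).2 hint
      refine h2.congr (Eventually.of_forall fun z => ?_)
      simp [Circle.coe_exp]
    · have : ∀ θ : ℝ, ∫ z, ‖K (Complex.exp (θ * Complex.I) * z)‖ = ∫ z, ‖K z‖ := fun θ => by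
        have h := integral_comp_mul_left_of_norm_one (fun z => (‖K z‖ : ℂ)) (hnorm θ)
        rw [integral_complex_ofReal, integral_complex_ofReal] at h
        exact_mod_cast h
      simp only [Function.uncurry_apply_pair, this]
      exact integrable_const _
  have hswap := integral_integral_swap hprod
  have hL : ∀ θ : ℝ, ∫ z, K (Complex.exp (θ * Complex.I) * z) = 0 := fun θ => by
    rw [integral_comp_mul_left_of_norm_one K (hnorm θ), h0]
  have hR : ∀ z : ℂ, ∫ θ, K (Complex.exp (θ * Complex.I) * z) ∂ν =
      (2 * Real.pi / n.factorial * iteratedDeriv n G 0 * (n.factorial / Real.pi ^ n)) *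
        ((poissonWeight n (Real.pi * ‖z - 0‖ ^ 2)).toReal : ℂ) := fun z => by
    rw [hν, ← intervalIntegral.integral_of_le (by positivity)]
    calc _ = ∫ θ in (0 : ℝ)..2 * Real.pi, (conj z ^ n * (Real.exp (-Real.pi * ‖z‖ ^ 2) : ℂ)) *
            (conj (Complex.exp (θ * Complex.I)) ^ n * G (Complex.exp (θ * Complex.I) * z)) := by
          refine intervalIntegral.integral_congr fun θ _ => ?_
          simp only [hK, map_mul, norm_mul, hnorm, one_mul]
          ring
      _ = _ := by
          rw [intervalIntegral.integral_const_mul, integral_conj_pow_mul_circle hG, sub_zero,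
            poissonWeight_of_nonneg _ (by positivity), ENNReal.toReal_ofReal (by positivity),
            mul_pow, ← pow_mul, mul_comm 2 n, pow_mul']
          push_cast
          rw [← Complex.conj_mul', mul_pow]
          have h1 : (n.factorial : ℂ) ≠ 0 := by exact_mod_cast n.factorial_ne_zero
          have h2 : (Real.pi : ℂ) ≠ 0 := by exact_mod_cast Real.pi_ne_zero
          field_simp
  simp only [hL, hR, integral_zero] at hswap
  have hm : AEMeasurable (fun z : ℂ => poissonWeight n (Real.pi * ‖z - 0‖ ^ 2)) :=
    ((measurable_poissonWeight n).comp (measurable_area 0)).aemeasurable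
  rw [integral_const_mul, integral_complex_ofReal, integral_toReal hm
    (Eventually.of_forall fun z => (poissonWeight_ne_top _ _).lt_top),
    lintegral_poissonWeight_area] at hswap
  have h1 : (n.factorial : ℂ) ≠ 0 := by exact_mod_cast n.factorial_ne_zero
  have h2 : (Real.pi : ℂ) ≠ 0 := by exact_mod_cast Real.pi_ne_zero
  simpa [h1, h2] using hswap.symm

/-- Undoing the Weyl translation gives an entire `G` whose Gaussian moments against all `conj z ^ k`
vanish; hence its Taylor series at 0 is zero. -/
theorem eq_zero_of_inner_fockVec_eq_zero (w : ℂ) (f : fockSpace)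
    (hf : ∀ k, inner ℂ (fockVec w k) f = 0) : f = 0 := by
  obtain ⟨f, F, hF, hfF⟩ := f
  set G : ℂ → ℂ := fun z => F (z + w) *
    Complex.exp (-Real.pi * conj w * z - Real.pi * ‖w‖ ^ 2 / 2) with hGdef
  have hG : Differentiable ℂ G := by
    have : Differentiable ℂ fun z => F (z + w) := hF.comp (by fun_prop)
    fun_prop
  have hkey : ∀ (k : ℕ) (z : ℂ),
      (Real.exp (-Real.pi * ‖z + w‖ ^ 2) : ℂ) * (conj (fockFun w k (z + w)) * F (z + w)) =
        (Real.sqrt (Real.pi ^ k / k.factorial) : ℂ) *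
          (conj z ^ k * G z * (Real.exp (-Real.pi * ‖z‖ ^ 2) : ℂ)) := by
    intro k z
    have h : Complex.exp (-Real.pi * ‖z + w‖ ^ 2) *
          conj (Complex.exp (Real.pi * conj w * (z + w) - Real.pi * ‖w‖ ^ 2 / 2)) =
        Complex.exp (-Real.pi * conj w * z - Real.pi * ‖w‖ ^ 2 / 2) *
          Complex.exp (-Real.pi * ‖z‖ ^ 2) := by
      rw [← Complex.exp_conj, ← Complex.exp_add, ← Complex.exp_add]
      congr 1
      simp only [map_sub, map_add, map_mul, map_div₀, Complex.conj_conj, Complex.conj_ofReal,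
        Complex.conj_ofNat, ← Complex.conj_mul']
      ring
    simp only [fockFun, hGdef, map_mul, map_pow, Complex.conj_ofReal, add_sub_cancel_right]
    push_cast
    linear_combination (Real.sqrt (Real.pi ^ k / k.factorial) : ℂ) * conj z ^ k * F (z + w) * h
  have hae : ∀ k, (fun z => inner ℂ (((fockVec w k : L2Gauss) : ℂ → ℂ) z) ((f : ℂ → ℂ) z))
      =ᵐ[gaussianMeasure] fun z => conj (fockFun w k z) * F z := fun k => by
    filter_upwards [coeFn_fockVec w k, hfF] with z h1 h2
    rw [h1, h2, RCLike.inner_apply, mul_comm]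
  have hc : ∀ k : ℕ, (Real.sqrt (Real.pi ^ k / k.factorial) : ℂ) ≠ 0 := fun k => by
    have : 0 < Real.sqrt (Real.pi ^ k / k.factorial) := by positivity
    exact_mod_cast this.ne'
  have hder : ∀ k, iteratedDeriv k G 0 = 0 := by
    intro k
    have hi : Integrable (fun z => conj (fockFun w k z) * F z) gaussianMeasure :=
      (L2.integrable_inner (𝕜 := ℂ) (fockVec w k : L2Gauss) f).congr (hae k)
    rw [integrable_gaussianMeasure_iff] at hi
    have hi2 := hi.comp_add_right w
    simp only [hkey] at hi2
    have h0 : ∫ z, conj (fockFun w k z) * F z ∂gaussianMeasure = 0 := by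
      rw [← integral_congr_ae (hae k), ← L2.inner_def]
      exact hf k
    rw [integral_gaussianMeasure, ← integral_add_right_eq_self _ w] at h0
    simp only [hkey] at h0
    rw [integral_const_mul, mul_eq_zero, or_iff_right (hc k)] at h0
    refine iteratedDeriv_eq_zero_of_integral_eq_zero hG k ?_ h0
    exact (integrable_const_mul_iff (isUnit_iff_ne_zero.2 (hc k)) _).1 hi2
  have hG0 : ∀ z, G z = 0 := fun z => by
    rw [← Complex.taylorSeries_eq_of_entire hG 0 z]
    simp [hder]
  have hF0 : F = 0 := by
    ext z
    have := hG0 (z - w)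
    simpa [hGdef] using this
  refine Subtype.ext (Lp.ext (hfF.trans ?_))
  rw [hF0]
  exact (Lp.coeFn_zero _ _ _).symm

/-- The monomials centred at `w`, as a Hilbert basis of the Fock space. -/
noncomputable def fockBasis (w : ℂ) : HilbertBasis ℕ ℂ fockSpace :=
  HilbertBasis.mkOfOrthogonalEqBot (orthonormal_fockVec w) <| by
    rw [Submodule.eq_bot_iff]
    exact fun f hf => eq_zero_of_inner_fockVec_eq_zero w f fun k =>
      (Submodule.mem_orthogonal _ _).1 hf _ (Submodule.subset_span ⟨k, rfl⟩)

theorem fockBasis_apply (w : ℂ) (k : ℕ) : fockBasis w k = fockVec w k := by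
  rw [fockBasis, HilbertBasis.coe_mkOfOrthogonalEqBot]

/-! ### Toeplitz operators of radial sets -/

/-- The eigenvalues of the Toeplitz operator of a set `Ω` which is radial about `w`. -/
noncomputable def radialEigenvalue (w : ℂ) (Ω : Set ℂ) (k : ℕ) : ℝ≥0∞ :=
  ∫⁻ z in Ω, poissonWeight k (Real.pi * ‖z - w‖ ^ 2)

/-- Compare coefficients: paired with an element of the Fock space, the projection drops out, and
the diagonal matrix of `χ_Ω` remains. -/
theorem toeplitz_fockBasis {Ω : Set ℂ} (hΩ : NullMeasurableSet Ω volume) {w : ℂ}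
    {E : Set ℝ} (hE : Ω = {z | ‖z - w‖ ∈ E}) (k : ℕ) :
    toeplitz Ω hΩ (fockBasis w k) =
      (((radialEigenvalue w Ω k).toReal : ℝ) : ℂ) • fockBasis w k := by
  refine (fockBasis w).repr.injective (lp.ext (funext fun j => ?_))
  have hsmul : ∀ a : ℂ, inner ℂ (fockBasis w j) (a • fockBasis w k) =
      a * inner ℂ (fockBasis w j) (fockBasis w k) := fun a => by
    rw [Submodule.coe_inner, Submodule.coe_inner, Submodule.coe_smul, inner_smul_right]
  rw [HilbertBasis.repr_apply_apply, HilbertBasis.repr_apply_apply, hsmul,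
    orthonormal_iff_ite.1 (fockBasis w).orthonormal, fockBasis_apply, fockBasis_apply]
  have h : inner ℂ (fockVec w j) (toeplitz Ω hΩ (fockVec w k)) =
      inner ℂ (fockVec w j : L2Gauss) (mulIndicator Ω hΩ (fockVec w k : L2Gauss)) :=
    Submodule.inner_orthogonalProjectionOnto_eq_of_mem_left _ _
  rw [h, inner_fockVec_mulIndicator hΩ hE, radialEigenvalue]
  split_ifs <;> simp

/-- The distribution of the area coordinate `π |z - w|²` on `Ω`. -/
noncomputable def areaMeasure (w : ℂ) (Ω : Set ℂ) : Measure ℝ :=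
  (volume.restrict Ω).map fun z : ℂ => Real.pi * ‖z - w‖ ^ 2

theorem radialEigenvalue_eq (w : ℂ) (Ω : Set ℂ) (k : ℕ) :
    radialEigenvalue w Ω k = ∫⁻ t, poissonWeight k t ∂areaMeasure w Ω :=
  (lintegral_map (measurable_poissonWeight k) (measurable_area w)).symm

theorem areaMeasure_le (w : ℂ) (Ω : Set ℂ) :
    areaMeasure w Ω ≤ volume.restrict (Set.Ici (0 : ℝ)) := by
  rw [← map_area_volume w]
  exact Measure.map_mono Measure.restrict_le_self (measurable_area w)

theorem areaMeasure_univ (w : ℂ) (Ω : Set ℂ) : areaMeasure w Ω Set.univ = volume Ω := by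
  rw [areaMeasure, Measure.map_apply (measurable_area w) MeasurableSet.univ]
  simp

theorem areaMeasure_Iio_zero (w : ℂ) (Ω : Set ℂ) : areaMeasure w Ω (Set.Iio 0) = 0 := by
  refine le_antisymm ((areaMeasure_le w Ω _).trans_eq ?_) zero_le
  rw [Measure.restrict_apply measurableSet_Iio, Set.Iio_inter_Ici]
  simp

theorem tsum_radialEigenvalue (w : ℂ) (Ω : Set ℂ) :
    ∑' k, radialEigenvalue w Ω k = volume Ω := by
  simp only [radialEigenvalue_eq]
  rw [tsum_lintegral_poissonWeight (areaMeasure_Iio_zero w Ω), areaMeasure_univ]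

theorem sum_radialEigenvalue_le (w : ℂ) {Ω : Set ℂ} (hfin : volume Ω < ∞) (S : Finset ℕ) :
    ∑ k ∈ S, radialEigenvalue w Ω k ≤ poissonTime S.card (volume Ω).toReal := by
  have : IsFiniteMeasure (areaMeasure w Ω) := ⟨by rwa [areaMeasure_univ]⟩
  have h := sum_lintegral_poissonWeight_le (areaMeasure w Ω)
    ((areaMeasure_le w Ω).trans Measure.restrict_le_self) S 0
  simp only [sub_zero, ← radialEigenvalue_eq] at h
  refine h.trans (poissonTime_mono _ ?_)
  rw [← areaMeasure_univ w Ω]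
  exact measureReal_mono (Set.subset_univ _)

theorem radialEigenvalue_ball (c : ℂ) (r : ℝ) (k : ℕ) :
    radialEigenvalue c (Metric.ball c r) k =
      ∫⁻ t in Set.Iio (volume (Metric.ball c r)).toReal, poissonWeight k t := by
  have h : Metric.ball c r = (fun z : ℂ => Real.pi * ‖z - c‖ ^ 2) ⁻¹'
      Set.Iio (volume (Metric.ball c r)).toReal := by
    rw [preimage_area_Iio, Complex.volume_ball]
    rcases le_total r 0 with hr | hr
    · simp [Metric.ball_eq_empty.2 hr, ENNReal.ofReal_of_nonpos hr]
    · simp [ENNReal.toReal_ofReal hr, Real.sqrt_sq hr]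
  set a := (volume (Metric.ball c r)).toReal with ha
  rw [radialEigenvalue_eq, areaMeasure, h, ← Measure.restrict_map (measurable_area c)
    measurableSet_Iio, map_area_volume, Measure.restrict_restrict measurableSet_Iio,
    ← lintegral_indicator (measurableSet_Iio.inter measurableSet_Ici),
    ← lintegral_indicator measurableSet_Iio]
  refine lintegral_congr fun t => ?_
  rcases lt_or_ge t 0 with ht | ht
  · simp [Set.indicator, ht, ht.not_ge, poissonWeight_of_neg]
  · simp [Set.indicator, ht]

/-- Finite area makes the eigenvalues summable, so each positive value is attained finitely often.
-/
theorem schattenNorm_toeplitz {Ω : Set ℂ} (hΩ : NullMeasurableSet Ω volume) {w : ℂ}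
    {E : Set ℝ} (hE : Ω = {z | ‖z - w‖ ∈ E}) (hfin : volume Ω < ∞) {p : ℝ} (hp : 0 < p) :
    schattenNorm p (toeplitz Ω hΩ) = (∑' k, radialEigenvalue w Ω k ^ p) ^ (1 / p) := by
  have hsum : ∑' k, radialEigenvalue w Ω k ≠ ∞ := (tsum_radialEigenvalue w Ω).trans_ne hfin.ne
  have hne : ∀ k, radialEigenvalue w Ω k ≠ ∞ := ENNReal.ne_top_of_tsum_ne_top hsum
  rw [schattenNorm_of_diagonal (fockBasis w) _ (toeplitz_fockBasis hΩ hE) _ hp]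
  · simp only [ENNReal.ofReal_toReal (hne _)]
  · intro t ht
    refine (ENNReal.finite_const_le_of_tsum_ne_top hsum
      (ε := ENNReal.ofReal t) (ENNReal.ofReal_pos.2 ht).ne').subset fun k hk => ?_
    have hk : (radialEigenvalue w Ω k).toReal = t := hk
    simp [← hk, hne k]

end FockToeplitz

/-! ### Comparison with the ball -/

theorem corollary1p5 (Ω : Set ℂ) (hΩ : NullMeasurableSet Ω volume)
    (hsymm : IsCircularlySymmetric Ω) (hfin : volume Ω < ∞)
    (c : ℂ) (r : ℝ) (hr : volume (Metric.ball c r) = volume Ω) :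
    (∀ p : ℝ, 1 < p →
      schattenNorm p (toeplitz Ω hΩ) ≤
        schattenNorm p (toeplitz (Metric.ball c r) measurableSet_ball.nullMeasurableSet) ∧
      schattenNorm p (toeplitz (Metric.ball c r) measurableSet_ball.nullMeasurableSet) < ∞) ∧
    (∀ p : ℝ, 0 < p → p < 1 →
      schattenNorm p (toeplitz (Metric.ball c r) measurableSet_ball.nullMeasurableSet) ≤
        schattenNorm p (toeplitz Ω hΩ) ∧
      schattenNorm p (toeplitz (Metric.ball c r) measurableSet_ball.nullMeasurableSet) < ∞) := by
  obtain ⟨w, E, -, -, hE⟩ := hsymm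
  have hB : Metric.ball c r = {z | ‖z - c‖ ∈ Set.Iio r} := by
    ext z
    simp [dist_eq_norm]
  have hBfin : volume (Metric.ball c r) < ∞ := hr ▸ hfin
  have hSΩ := fun {p : ℝ} (hp : 0 < p) => schattenNorm_toeplitz hΩ hE hfin hp
  have hSB := fun {p : ℝ} (hp : 0 < p) =>
    schattenNorm_toeplitz measurableSet_ball.nullMeasurableSet hB hBfin hp
  -- The two operators are diagonal in bases centred at `w` and at `c`; only the eigenvalue
  -- sequences are compared. The first `N` eigenvalues of the ball sum to `poissonTime N` at the
  -- common area.
  have hmaj : ∀ S : Finset ℕ, ∑ k ∈ S, radialEigenvalue w Ω k ≤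
      ∑ k ∈ Finset.range S.card, radialEigenvalue c (Metric.ball c r) k := fun S => by
    simp only [radialEigenvalue_ball, hr]
    exact sum_radialEigenvalue_le w hfin S
  have hsum : ∑' k, radialEigenvalue w Ω k =
      ∑' k, radialEigenvalue c (Metric.ball c r) k := by
    rw [tsum_radialEigenvalue, tsum_radialEigenvalue, hr]
  have hne : ∑' k, radialEigenvalue c (Metric.ball c r) k ≠ ∞ :=
    (tsum_radialEigenvalue _ _).trans_ne hBfin.ne
  have hlt : ∀ p : ℝ, 0 < p →
      schattenNorm p (toeplitz (Metric.ball c r) measurableSet_ball.nullMeasurableSet) < ∞ := by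
    intro p hp
    rw [hSB hp]
    simp only [radialEigenvalue_ball]
    exact ENNReal.rpow_lt_top_of_nonneg (by positivity)
      (tsum_lintegral_Iio_poissonWeight_rpow_lt_top ENNReal.toReal_nonneg hp).ne
  refine ⟨fun p hp => ⟨?_, hlt p (by linarith)⟩, fun p hp0 hp => ⟨?_, hlt p hp0⟩⟩
  · have hp0 : 0 < p := by linarith
    rw [hSΩ hp0, hSB hp0]
    exact ENNReal.rpow_le_rpow (tsum_rpow_le_of_majorized hmaj hsum hne hp) (by positivity)
  · rw [hSΩ hp0, hSB hp0]
    exact ENNReal.rpow_le_rpow (tsum_rpow_le_of_majorized_of_lt_one hmaj hsum hne hp0 hp)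
      (by positivity)
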